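/- **Bottom edge lemma.** Let $x$ be a feasible half-integral solution of the subtour (Held–Karp) LP on a finite vertex set $V$: $x_{\{u,v\}}\in\{0,\tfrac12,1\}$, $\sum_v x_{\{u,v\}}=2$ for every $u$, and $x(\delta(S))\ge 2$ for every $\emptyset\ne S\subsetneq V$. Let $e^+$ be a pair with $x_{e^+}=1$, and let $G$ be the support multigraph of $x$ (one edge for each pair of value $\tfrac12$, two parallel edges for each pair of value $1$). A vertex set $S$ of $G$ or of a contraction of $G$ is *tight* if $|\delta(S)|=4$, and *proper* if $S$ and its complement both have at least two vertices; two sets $S,S'$ *cross* if $S\setminus S'$, $S'\setminus S$, $S\cap S'$ and the complement of $S\cup S'$ are all non-empty. Consider any execution of the following procedure. While the current graph has a proper tight set crossed by no tight set, choose an inclusion-minimal such set $S$ with $e^+\notin E(S)$; sample a spanning tree of $(S,E(S))$ from the maximum entropy distribution with marginals $\tfrac12$ (a distribution in which the probability of a tree is proportional to the product of nonnegative weights of its edges, and every edge of $E(S)$ is in the tree with probability $\tfrac12$); contract $S$. When the loop ends, sample uniformly a cycle through all vertices of the remaining graph that contains (a copy of) $e^+$. All samples are independent, and $T$ is the union of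 the sampled edge sets. The sets $S$ chosen in the loop, viewed as sets of original vertices, and the single vertices as degenerate ones, are the *critical sets*; the root of their hierarchy is the graph that remains at the end. For an edge $e=\{u,v\}$ of $G$, let $S_{u,e}$ be the highest (largest) critical set that contains $u$ but not $v$, define $S_{v,e}$ symmetrically, and let $S_e$ be the critical set, or the root, that has both $S_{u,e}$ and $S_{v,e}$ as (contracted) vertices. A critical set $S$ gives a *cycle cut* if, at the time it is chosen, it has exactly two vertices or it strictly contains a proper tight set; the root counts as a cycle cut as well. An edge $e$ is a *bottom edge* if $S_e$ is a cycle cut. A bottom edge $e$ is *even at last* if every minimum cut containing $e$ in the graph obtained from the graph at the time $S_e$ is chosen by contracting the complement of $S_e$ (for the root: in the remaining graph itself) has an even number of edges in $T$; among these cuts are the two last cuts of $e$. Two edges of $\delta(S_e)$ are *cycle partners* if they have the same end vertex inside $S_e$ at the time $S_e$ is chosen. Then every bottom edge $e$ is good with constant $p = 3/16$, that is, $$\Pr[e\text{ is even at last}]\ \ge\ \tfrac{3}{16}.$$ Moreover, the probability that each pair of cycle partners on $\delta(S_e)$ has exactly one edge in $T$ is also at least $\tfrac{3}{16}$ (for the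 root there are no such pairs). -/

import Mathlib

/-- An edge of a multigraph on `V` with multiplicities at most two: a pair of end points and the
number of the copy. -/
abbrev Edge (V : Type*) := Sym2 V × Fin 2

namespace HalfIntegralTSP

variable {V : Type*} [Fintype V] [DecidableEq V]

/-- `x` is a feasible half-integral solution of the subtour elimination (Held-Karp) LP on the
vertex set `V`. -/
structure IsHalfIntegralSubtour (x : Sym2 V → ℝ) : Prop where
  loopless : ∀ v, x s(v, v) = 0
  half_integral : ∀ f, x f = 0 ∨ x f = 1 / 2 ∨ x f = 1
  degree : ∀ u, ∑ v, x s(u, v) = 2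
  subtour : ∀ S : Finset V, S.Nonempty → S ≠ Finset.univ → 2 ≤ ∑ u ∈ S, ∑ v ∈ Sᶜ, x s(u, v)

open Classical in
/-- The support graph of `x`, in which a pair of value `1 / 2` is one edge and a pair of value `1`
is two parallel edges. -/
noncomputable def supportGraph (x : Sym2 V → ℝ) : Finset (Edge V) :=
  Finset.univ.filter fun e => ((e.2 : ℕ) : ℝ) + 1 ≤ 2 * x e.1

/-- The edge `e` joins a vertex of `X` to a vertex of `Y`. -/
def Joins (e : Edge V) (X Y : Finset V) : Prop :=
  ∃ u ∈ X, ∃ v ∈ Y, e.1 = s(u, v)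

open Classical in
/-- The cut `δ(X)` in the graph `G`. -/
noncomputable def cut (G : Finset (Edge V)) (X : Finset V) : Finset (Edge V) :=
  G.filter fun e => Joins e X Xᶜ

/-! A contraction of `G` is represented by its set `N` of nodes, a partition of `V` whose parts are
the sets of original vertices that have been merged. A set of vertices of the contracted graph is a
subset `A` of `N`. -/

/-- The original vertices in a set of nodes. -/
def verts (A : Finset (Finset V)) : Finset V := A.biUnion id

open Classical in
/-- The edges `E(A)` of the contracted graph with both ends in the set `A` of nodes; an edge inside
a single node has disappeared. -/
noncomputable def innerEdges (G : Finset (Edge V)) (A : Finset (Finset V)) : Finset (Edge V) :=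
  G.filter fun e => ∃ X ∈ A, ∃ Y ∈ A, X ≠ Y ∧ Joins e X Y

/-- A set of nodes is tight if its boundary has `4` edges, the size of a minimum cut. -/
def IsTight (G : Finset (Edge V)) (A : Finset (Finset V)) : Prop :=
  (cut G (verts A)).card = 4

/-- `A` is a proper set of vertices of the graph with vertex set `N`. -/
def IsProper (N A : Finset (Finset V)) : Prop :=
  A ⊆ N ∧ 2 ≤ A.card ∧ 2 ≤ (N \ A).card

/-- `A` and `B` cross in the graph with vertex set `N`. -/
def Crosses (N A B : Finset (Finset V)) : Prop :=
  (A \ B).Nonempty ∧ (B \ A).Nonempty ∧ (A ∩ B).Nonempty ∧ (N \ (A ∪ B)).Nonempty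

/-- `A` is a proper tight set of the contracted graph which no tight set crosses. -/
def IsUncrossed (G : Finset (Edge V)) (N A : Finset (Finset V)) : Prop :=
  IsProper N A ∧ IsTight G A ∧ ∀ B ⊆ N, IsTight G B → ¬ Crosses N A B

/-- `A` is an uncrossed proper tight set with `f ∉ E(A)`. -/
def IsCandidate (G : Finset (Edge V)) (f : Sym2 V) (N A : Finset (Finset V)) : Prop :=
  IsUncrossed G N A ∧ ¬ ∀ v ∈ f, v ∈ verts A

/-- The edges in `T` connect the nodes in `A`. -/
def Connects (T : Finset (Edge V)) (A : Finset (Finset V)) : Prop :=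
  ∀ X ∈ A, ∀ Y ∈ A,
    Relation.ReflTransGen (fun X' Y' => X' ∈ A ∧ Y' ∈ A ∧ ∃ e ∈ T, Joins e X' Y') X Y

/-- `T` is a spanning tree of the contracted graph `(A, E(A))`. -/
def IsSpanningTree (G : Finset (Edge V)) (A : Finset (Finset V)) (T : Finset (Edge V)) : Prop :=
  T ⊆ innerEdges G A ∧ Connects T A ∧ T.card + 1 = A.card

open Classical in
/-- `p` is the maximum entropy distribution on the spanning trees of `(A, E(A))` with the
marginals `1 / 2` that the LP solution gives to every edge of the support graph: the probability of
a tree is proportional to the product of nonnegative weights of its edges. -/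
def IsMaxEntropy (G : Finset (Edge V)) (A : Finset (Finset V))
    (p : Finset (Edge V) → ℝ) : Prop :=
  (∃ w : Edge V → ℝ, (∀ e, 0 ≤ w e) ∧
    0 < ∑ T ∈ Finset.univ.filter (IsSpanningTree G A), ∏ e ∈ T, w e ∧
    ∀ T, p T = if IsSpanningTree G A T then
      (∏ e ∈ T, w e) / ∑ T' ∈ Finset.univ.filter (IsSpanningTree G A), ∏ e ∈ T', w e
      else 0) ∧
  ∀ e ∈ innerEdges G A, ∑ T ∈ Finset.univ.filter (fun T => e ∈ T), p T = 1 / 2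

/-- `T` is a cycle through all nodes in `N` of the contracted graph, and it contains a copy of
`f`. -/
def IsTour (G : Finset (Edge V)) (f : Sym2 V) (N : Finset (Finset V))
    (T : Finset (Edge V)) : Prop :=
  T ⊆ innerEdges G N ∧ Connects T N ∧ (∀ X ∈ N, (T ∩ cut G X).card = 2) ∧ ∃ e ∈ T, e.1 = f

open Classical in
/-- The uniform distribution on these cycles. -/
noncomputable def tourLaw (G : Finset (Edge V)) (f : Sym2 V) (N : Finset (Finset V))
    (T : Finset (Edge V)) : ℝ :=
  if IsTour G f N T then 1 / ((Finset.univ.filter (IsTour G f N)).card : ℝ) else 0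

/-- An execution of the sampling algorithm on the graph `G` with distinguished pair `f` (the pair
`e⁺` of value `1`). The while loop is run `k` times. Before round `i` the graph has been contracted
to the node set `nodes i`; round `i < k` selects the set `sel i`, samples a spanning tree on it
from `law i`, and contracts it. When the loop ends, a cycle through the remaining graph is sampled
uniformly; this is step `k`, with `sel k` the set of all remaining nodes. -/
structure Execution (G : Finset (Edge V)) (f : Sym2 V) where
  k : ℕ
  nodes : ℕ → Finset (Finset V)
  sel : ℕ → Finset (Finset V)
  law : ℕ → Finset (Edge V) → ℝ
  nodes_zero : nodes 0 = Finset.univ.image fun v => {v}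
  sel_candidate : ∀ i < k, IsCandidate G f (nodes i) (sel i)
  sel_minimal : ∀ i < k, ∀ B ⊂ sel i, ¬ IsCandidate G f (nodes i) B
  nodes_succ : ∀ i < k, nodes (i + 1) = insert (verts (sel i)) (nodes i \ sel i)
  law_maxEntropy : ∀ i < k, IsMaxEntropy G (sel i) (law i)
  loop_end : ∀ A, ¬ IsUncrossed G (nodes k) A
  sel_last : sel k = nodes k
  law_last : law k = tourLaw G f (nodes k)

namespace Execution

variable {G : Finset (Edge V)} {f : Sym2 V} (R : Execution G f)

open Classical in
/-- The probability that the random edge set `T` has the property `Q`, where `T` is the union of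
independent samples from the distributions `law 0, …, law k`. -/
noncomputable def prob (Q : Finset (Edge V) → Prop) : ℝ :=
  ∑ ω : Fin (R.k + 1) → Finset (Edge V),
    if Q (Finset.univ.biUnion ω) then ∏ i : Fin (R.k + 1), R.law i (ω i) else 0

/-- The critical sets are the selected sets, and the vertices as degenerate critical sets. -/
def IsCritical (X : Finset V) : Prop :=
  (∃ v, X = {v}) ∨ ∃ i < R.k, X = verts (R.sel i)

/-- `X` is the highest critical set that contains `u` but not `v`. -/
def IsHighest (u v : V) (X : Finset V) : Prop :=
  R.IsCritical X ∧ u ∈ X ∧ v ∉ X ∧ ∀ Y, R.IsCritical Y → u ∈ Y → v ∉ Y → Y ⊆ X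

/-- `S_e` is the set selected in round `i` (for `i = k`, the root of the hierarchy): the highest
critical sets that contain exactly one end of `e` are nodes of it. A node belongs to the selected
set of one round only, so that there is at most one such `i`. -/
def IsParentIndex (e : Edge V) (i : ℕ) : Prop :=
  i ≤ R.k ∧ ∃ u v X Y, e.1 = s(u, v) ∧ R.IsHighest u v X ∧ R.IsHighest v u Y ∧
    X ∈ R.sel i ∧ Y ∈ R.sel i

/-- The set selected in round `i` is a cycle cut: there is a proper minimum cut inside it, or it
has two nodes only, so that contracting its complement gives a triangle with doubled edges. The
last step `i = k` samples from a cycle, and counts as well. -/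
def IsCycle (i : ℕ) : Prop :=
  i = R.k ∨ (R.sel i).card = 2 ∨ ∃ B ⊂ R.sel i, 2 ≤ B.card ∧ IsTight G B

/-- `e` is a bottom edge: `S_e` is a cycle cut. -/
def IsBottom (e : Edge V) : Prop :=
  ∃ i, R.IsParentIndex e i ∧ R.IsCycle i

/-- `e` is even at last. For a bottom edge: all minimum cuts containing `e` of the cycle which
results from `S_e` by contracting its complement (among them the two last cuts of `e`) have an even
number of edges in `T`. For a top edge: so have the two cuts defined by the nodes of `S_e` that
contain one end of `e`. -/
def EvenAtLast (e : Edge V) (T : Finset (Edge V)) : Prop :=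
  ∃ i, R.IsParentIndex e i ∧
    (R.IsCycle i → ∀ B ⊆ R.sel i, IsTight G B → e ∈ cut G (verts B) →
      Even (T ∩ cut G (verts B)).card) ∧
    (¬ R.IsCycle i → ∀ X ∈ R.sel i, e ∈ cut G X → Even (T ∩ cut G X).card)

/-- `e` is good with constant `p`. -/
def IsGood (e : Edge V) (p : ℝ) : Prop :=
  0 < p ∧ p ≤ R.prob (R.EvenAtLast e)

/-- `a` and `b` are cycle partners with respect to the boundary of the set selected in round `i`:
two edges of this boundary with the same end node inside the set. -/
def IsCyclePartners (i : ℕ) (a b : Edge V) : Prop :=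
  a ≠ b ∧ a ∈ cut G (verts (R.sel i)) ∧ b ∈ cut G (verts (R.sel i)) ∧
    ∃ X ∈ R.sel i, a ∈ cut G X ∧ b ∈ cut G X

/-- From each pair of cycle partners on the boundary of `S_e`, exactly one edge is in `T`. -/
def PartnersSplit (e : Edge V) (T : Finset (Edge V)) : Prop :=
  ∃ i, R.IsParentIndex e i ∧ ∀ a b, R.IsCyclePartners i a b → Xor (a ∈ T) (b ∈ T)

end Execution

end HalfIntegralTSP

/-! The structural half of the proof shows that all edges of a cycle cut come in parallel pairs.
Contract the complement of `S_e` to one node. By minimality of the chosen set, every proper minimum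
cut of the resulting graph is crossed by another one. The four corners of two crossing minimum cuts
form a doubled 4-cycle (`corners_of_crossing`). Descending into corners gives `eq_zero_or_two`: two
nodes are joined by no edge or by exactly two. `card_joinEdges_of_minimal` and `card_joinEdges_last`
transfer this to the sets chosen in the loop and to the root.

The sampling inside a cycle cut then causes no loss. A tree contains at most one of two parallel
edges, and on average it contains 1/2 + 1/2 of them, so almost surely exactly one
(`IsMaxEntropy.card_inter_joinEdges`). The four edges leaving `S_e` form two parallel pairs in the
contracted graph, which are the pairs of cycle partners. If both are split by `T`, every node of
`S_e` has degree 2 in `T`. By additivity of cuts modulo 2, every cut given by nodes of `S_e` is then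
even. At the root, all nodes have degree 2 in the tour, and nothing is left to show.

It remains to bound the probability that two disjoint pairs are both split. Spanning-tree laws are
determinantal by the weighted matrix-tree theorem. So is the tour law, because a tour of a doubled
cycle is a free choice of one edge from each parallel pair (`isTour_iff`). Independent unions over
disjoint ground sets preserve this property, so all of `T` has one kernel `K`, with diagonal 1/2 on
`G`. Expanding the two split indicators in signs expresses the probability by principal minors of `1
- 2K`, and an elementary inequality gives at least 1/4 (`quarter_le_split`). This exceeds the
required 3/16 and bounds both events of the theorem at once. -/

namespace HalfIntegralTSP

open Matrix

/-! ### Gram determinants and projection kernels. -/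

/-- Symmetrized Cauchy-Binet formula for a weighted Gram matrix. -/
theorem factorial_mul_det_gram {E n : Type*} [Fintype E] [DecidableEq E] [Fintype n]
    [DecidableEq n] (B : Matrix n E ℝ) (w : E → ℝ) :
    ((Fintype.card n).factorial : ℝ) * (B * diagonal w * Bᵀ).det =
      ∑ φ : n → E, (∏ i, w (φ i)) * (B.submatrix id φ).det ^ 2 := by
  -- Row `i` of the Gram matrix is a sum over `e` of multiples of column `e` of `B`. Multilinearity
  -- of the determinant picks one `φ i` for each row.
  have h1 : (B * diagonal w * Bᵀ).det =
      ∑ φ : n → E, (∏ i, (B i (φ i) * w (φ i))) * (B.submatrix id φ).det := by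
    have hrow : B * diagonal w * Bᵀ =
        Matrix.of fun i => ∑ e, (B i e * w e) • (fun j => B j e) := by
      ext i j
      rw [Matrix.mul_apply]
      simp only [Matrix.mul_diagonal, Matrix.transpose_apply, Matrix.of_apply, Finset.sum_apply,
        Pi.smul_apply, smul_eq_mul]
    rw [hrow]
    have := (Matrix.detRowAlternating (n := n) (R := ℝ)).toMultilinearMap.map_sum
      (fun i e => (B i e * w e) • (fun j => B j e))
    simp only [AlternatingMap.coe_multilinearMap] at this
    refine this.trans (Finset.sum_congr rfl fun φ _ => ?_)
    have h2 := (Matrix.detRowAlternating (n := n) (R := ℝ)).toMultilinearMap.map_smul_univ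
      (fun i => B i (φ i) * w (φ i)) (fun i j => B j (φ i))
    simp only [AlternatingMap.coe_multilinearMap] at h2
    rw [h2, smul_eq_mul, ← Matrix.det_transpose (B.submatrix id φ)]
    rfl
  -- Replacing `φ` by `φ ∘ σ` keeps the weight and multiplies the minor by the sign of `σ`. Summed
  -- over `σ`, the leftover product of entries becomes a second copy of the minor.
  have h2 : ∀ σ : Equiv.Perm n, (B * diagonal w * Bᵀ).det =
      ∑ φ : n → E, (∏ i, w (φ i)) * (B.submatrix id φ).det *
        (((Equiv.Perm.sign σ : ℤ) : ℝ) * ∏ i, B i (φ (σ i))) := by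
    intro σ
    rw [h1, ← (Equiv.arrowCongr σ.symm (Equiv.refl E)).sum_comp]
    refine Finset.sum_congr rfl fun φ _ => ?_
    have e1 : (Equiv.arrowCongr σ.symm (Equiv.refl E)) φ = φ ∘ σ := rfl
    have e2 : (B.submatrix id (φ ∘ σ)).det =
        ((Equiv.Perm.sign σ : ℤ) : ℝ) * (B.submatrix id φ).det :=
      Matrix.det_permute' σ (B.submatrix id φ)
    rw [e1, e2, Finset.prod_mul_distrib]
    have e3 : ∏ i, w ((φ ∘ σ) i) = ∏ i, w (φ i) := Equiv.prod_comp σ fun i => w (φ i)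
    rw [e3]
    simp only [Function.comp]
    ring
  have h3 : ∑ _σ : Equiv.Perm n, (B * diagonal w * Bᵀ).det =
      ((Fintype.card n).factorial : ℝ) * (B * diagonal w * Bᵀ).det := by
    rw [Finset.sum_const, Finset.card_univ, Fintype.card_perm, nsmul_eq_mul]
  rw [← h3, Finset.sum_congr rfl fun σ _ => h2 σ, Finset.sum_comm]
  refine Finset.sum_congr rfl fun φ _ => ?_
  rw [← Finset.mul_sum]
  have : (B.submatrix id φ).det =
      ∑ σ : Equiv.Perm n, ((Equiv.Perm.sign σ : ℤ) : ℝ) * ∏ i, B i (φ (σ i)) := by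
    rw [← Matrix.det_transpose, Matrix.det_apply']
    rfl
  rw [← this]
  ring

/-- If the square of every maximal minor of `B` is the indicator of the family `P`, then the
determinant of the weighted Gram matrix is the generating function of `P`. -/
theorem det_gram_eq_sum {E n : Type*} [Fintype E] [DecidableEq E] [Fintype n] [DecidableEq n]
    (B : Matrix n E ℝ) (P : Finset E → Prop) [DecidablePred P] (hcard : ∀ T, P T → T.card = Fintype.card n)
    (hdet : ∀ φ : n → E, Function.Injective φ →
      (B.submatrix id φ).det ^ 2 = if P (Finset.univ.image φ) then 1 else 0) (w : E → ℝ) :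
    (B * diagonal w * Bᵀ).det = ∑ T ∈ Finset.univ.filter P, ∏ e ∈ T, w e := by
  classical
  have hn : ((Fintype.card n).factorial : ℝ) ≠ 0 := by positivity
  apply mul_left_cancel₀ hn
  rw [factorial_mul_det_gram]
  have hterm : ∀ φ : n → E, (∏ i, w (φ i)) * (B.submatrix id φ).det ^ 2 =
      ∑ T ∈ Finset.univ.filter P,
        if Function.Injective φ ∧ Finset.univ.image φ = T then ∏ e ∈ T, w e else 0 := by
    intro φ
    by_cases hφ : Function.Injective φ
    · rw [hdet φ hφ, Finset.sum_filter]
      simp only [hφ, true_and]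
      rw [Finset.sum_eq_single (Finset.univ.image φ)]
      · by_cases hP : P (Finset.univ.image φ)
        · rw [if_pos hP, if_pos hP, if_pos rfl, mul_one, Finset.prod_image hφ.injOn]
        · rw [if_neg hP, if_neg hP, mul_zero]
      · intro T _ hT
        rw [if_neg (Ne.symm hT), ite_self]
      · simp
    · have : ∃ i j, i ≠ j ∧ φ i = φ j := by
        simp only [Function.Injective] at hφ
        push Not at hφ
        obtain ⟨i, j, h1, h2⟩ := hφ
        exact ⟨i, j, h2, h1⟩
      obtain ⟨i, j, hij, h⟩ := this
      rw [Matrix.det_zero_of_column_eq hij (fun k => by simp [h])]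
      simp [hφ]
  rw [Finset.sum_congr rfl fun φ _ => hterm φ, Finset.sum_comm, Finset.mul_sum]
  refine Finset.sum_congr rfl fun T hT => ?_
  have hT' := hcard T (Finset.mem_filter.1 hT).2
  rw [← Finset.sum_filter, Finset.sum_const, nsmul_eq_mul]
  congr 1
  norm_cast
  -- The factorial counts the bijections `n ≃ T`, which are the injective `φ` with image `T`.
  rw [← Fintype.card_equiv (Fintype.equivOfCardEq (by simp [hT']) : n ≃ T), ← Finset.card_univ]
  symm
  refine Finset.card_bij (fun ψ _ i => (ψ i : E)) ?_ ?_ ?_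
  · intro ψ _
    rw [Finset.mem_filter]
    refine ⟨Finset.mem_univ _, Subtype.val_injective.comp ψ.injective, ?_⟩
    ext e
    simp only [Finset.mem_image, Finset.mem_univ, true_and]
    constructor
    · rintro ⟨i, rfl⟩
      exact (ψ i).2
    · intro he
      exact ⟨ψ.symm ⟨e, he⟩, by simp⟩
  · intro ψ _ ψ' _ h
    ext i
    exact congrFun h i
  · intro φ hφ
    obtain ⟨_, hinj, him⟩ := Finset.mem_filter.1 hφ
    have hmem : ∀ i, φ i ∈ T := fun i => him ▸ Finset.mem_image_of_mem _ (Finset.mem_univ i)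
    have hbij : Function.Bijective (fun i => (⟨φ i, hmem i⟩ : T)) := by
      rw [Fintype.bijective_iff_injective_and_card]
      exact ⟨fun i j h => hinj (congrArg Subtype.val h), by simp [hT']⟩
    exact ⟨Equiv.ofBijective _ hbij, Finset.mem_univ _, rfl⟩

/-- A random set whose signed generating function is a determinant has a projection kernel. -/
theorem exists_kernel_of_det_gram {E n : Type*} [Fintype E] [DecidableEq E] [Fintype n] [DecidableEq n]
    (B : Matrix n E ℝ) (w : E → ℝ) (hw : ∀ e, 0 ≤ w e) (p : Finset E → ℝ)
    (hdet : (B * diagonal w * Bᵀ).det ≠ 0)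
    (hp : ∀ s : E → ℝ, ∑ T, p T * ∏ e ∈ T, s e =
      (B * diagonal (fun e => s e * w e) * Bᵀ).det / (B * diagonal w * Bᵀ).det) :
    ∃ K : Matrix E E ℝ, K.IsSymm ∧ (∀ e, ∑ f, K e f ^ 2 = K e e) ∧
      ∀ (m : ℕ) (a : Fin m → E), Function.Injective a →
        ∑ T, p T * ∏ j, (if a j ∈ T then (-1 : ℝ) else 1) =
          (1 - (2 : ℝ) • K.submatrix a a).det := by
  set L := B * diagonal w * Bᵀ with hL
  set C : Matrix n E ℝ := B * diagonal (fun e => √(w e)) with hC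
  have hCT : Cᵀ = diagonal (fun e => √(w e)) * Bᵀ := by
    rw [hC, Matrix.transpose_mul, Matrix.diagonal_transpose]
  have hCs : ∀ s : E → ℝ, C * diagonal s * Cᵀ = B * diagonal (fun e => s e * w e) * Bᵀ := by
    intro s
    rw [hCT, hC]
    simp only [Matrix.mul_assoc]
    congr 1
    simp only [← Matrix.mul_assoc, Matrix.diagonal_mul_diagonal]
    congr 2
    ext e
    rw [mul_left_comm, Real.mul_self_sqrt (hw e)]
  have hCC : C * Cᵀ = L := by
    have := hCs fun _ => 1
    simpa [hL] using this
  have hLu : IsUnit L.det := isUnit_iff_ne_zero.2 hdet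
  have hLs : Lᵀ = L := by rw [← hCC, Matrix.transpose_mul, Matrix.transpose_transpose]
  -- The orthogonal projection onto the row space of `C`. Idempotence and symmetry give the identity
  -- between a diagonal entry and the squared norm of its row.
  set K : Matrix E E ℝ := Cᵀ * L⁻¹ * C with hK
  have hKs : Kᵀ = K := by
    rw [hK]
    simp only [Matrix.transpose_mul, Matrix.transpose_transpose, Matrix.transpose_nonsing_inv, hLs,
      Matrix.mul_assoc]
  have hKK : K * K = K := by
    calc K * K = Cᵀ * L⁻¹ * (C * Cᵀ) * L⁻¹ * C := by rw [hK]; simp only [Matrix.mul_assoc]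
      _ = Cᵀ * (L⁻¹ * L) * L⁻¹ * C := by rw [hCC]; simp only [Matrix.mul_assoc]
      _ = K := by rw [Matrix.nonsing_inv_mul _ hLu, Matrix.mul_one]
  refine ⟨K, hKs, fun e => ?_, fun m a ha => ?_⟩
  · nth_rewrite 2 [← hKK]
    rw [Matrix.mul_apply]
    refine Finset.sum_congr rfl fun f _ => ?_
    rw [sq]
    congr 1
    nth_rewrite 1 [← hKs]
    rfl
  · set s : E → ℝ := fun e => if e ∈ Finset.univ.image a then -1 else 1 with hs
    set Q : Matrix E (Fin m) ℝ := Matrix.of fun e j => if e = a j then 1 else 0 with hQ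
    have hprod : ∀ T : Finset E, ∏ e ∈ T, s e = ∏ j, (if a j ∈ T then (-1 : ℝ) else 1) := by
      intro T
      calc ∏ e ∈ T, s e = ∏ e, if e ∈ T ∧ e ∈ Finset.univ.image a then (-1 : ℝ) else 1 := by
            rw [← Finset.prod_subset (Finset.subset_univ T)]
            · exact Finset.prod_congr rfl fun e he => by simp [hs, he]
            · intro e _ he
              simp [he]
        _ = ∏ e ∈ Finset.univ.image a, (if e ∈ T then (-1 : ℝ) else 1) := by
            symm
            rw [← Finset.prod_subset (Finset.subset_univ (Finset.univ.image a))]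
            · exact Finset.prod_congr rfl fun e he => by simp only [he, and_true]
            · intro e _ he
              simp only [he, and_false, if_false]
        _ = _ := Finset.prod_image ha.injOn
    -- Flipping the signs on the image of `a` is a perturbation that factors through `Fin m`. The
    -- matrix determinant lemma therefore reduces the determinant to size `m`.
    have hdiag : diagonal s = 1 + Q * ((-2 : ℝ) • Qᵀ) := by
      ext e f
      simp only [Matrix.add_apply, Matrix.mul_apply, Matrix.smul_apply, Matrix.transpose_apply,
        hQ, Matrix.of_apply, smul_eq_mul, Matrix.diagonal_apply, Matrix.one_apply, hs]
      by_cases hef : e = f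
      · subst hef
        simp only [if_true, Finset.mem_image, Finset.mem_univ, true_and]
        by_cases h : ∃ j, a j = e
        · obtain ⟨j, rfl⟩ := h
          rw [if_pos ⟨j, rfl⟩, Finset.sum_eq_single j]
          · simp; norm_num
          · intro k _ hk
            simp [ha.ne hk.symm]
          · simp
        · rw [if_neg h, Finset.sum_eq_zero]
          · simp
          · intro k _
            rw [if_neg fun h' => h ⟨k, h'.symm⟩]
            simp
      · rw [if_neg hef, if_neg hef, Finset.sum_eq_zero]
        · simp
        · intro k _
          by_cases h : e = a k
          · rw [if_neg fun h' : f = a k => hef (h.trans h'.symm)]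
            simp
          · simp [h]
    have hsub : Qᵀ * K * Q = K.submatrix a a := by
      ext i j
      simp [Matrix.mul_apply, hQ]
    have hmain : C * diagonal s * Cᵀ = L + (C * Q) * ((-2 : ℝ) • (Qᵀ * Cᵀ)) := by
      rw [hdiag, Matrix.mul_add, Matrix.add_mul, Matrix.mul_one, hCC]
      simp only [Matrix.mul_smul, Matrix.smul_mul, Matrix.mul_assoc]
    calc ∑ T, p T * ∏ j, (if a j ∈ T then (-1 : ℝ) else 1) = ∑ T, p T * ∏ e ∈ T, s e := by
          simp only [hprod]
      _ = (C * diagonal s * Cᵀ).det / L.det := by rw [hp s, hCs]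
      _ = (1 + (-2 : ℝ) • (Qᵀ * Cᵀ) * L⁻¹ * (C * Q)).det := by
          rw [hmain, Matrix.det_add_mul _ _ hLu, mul_div_cancel_left₀ _ hdet]
      _ = (1 - (2 : ℝ) • K.submatrix a a).det := by
          rw [← hsub, hK]
          simp only [Matrix.smul_mul, Matrix.mul_assoc, neg_smul, sub_eq_add_neg, Matrix.neg_mul]

/-! ### Determinantal laws with marginals one half. -/

/-- The law `p` of a random subset of `E` is determinantal, and every element of `E` has
probability `1 / 2`. -/
structure IsHalfDeterminantal {α : Type*} [Fintype α] [DecidableEq α] (p : Finset α → ℝ)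
    (E : Finset α) : Prop where
  nonneg : ∀ T, 0 ≤ p T
  support : ∀ T, p T ≠ 0 → T ⊆ E
  kernel : ∃ K : Matrix α α ℝ, K.IsSymm ∧ (∀ e, ∑ f, K e f ^ 2 ≤ K e e) ∧
    (∀ e ∈ E, K e e = 1 / 2) ∧ (∀ e ∉ E, K e e = 0) ∧
    ∀ (m : ℕ) (a : Fin m → α), Function.Injective a →
      ∑ T, p T * ∏ j, (if a j ∈ T then (-1 : ℝ) else 1) = (1 - (2 : ℝ) • K.submatrix a a).det

/-- The diagonal entry bounds the squared norm of its row, so a zero on the diagonal kills the row.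
-/
theorem kernel_eq_zero {α : Type*} [Fintype α] {K : Matrix α α ℝ}
    (hK : ∀ e, ∑ f, K e f ^ 2 ≤ K e e) {e : α} (he : K e e = 0) (f : α) : K e f = 0 := by
  have h1 : ∑ f, K e f ^ 2 = 0 :=
    le_antisymm (he ▸ hK e) (Finset.sum_nonneg fun _ _ => sq_nonneg _)
  have h2 := (Finset.sum_eq_zero_iff_of_nonneg fun f _ => sq_nonneg (K e f)).1 h1 f
    (Finset.mem_univ f)
  exact pow_eq_zero_iff two_ne_zero |>.1 h2

/-- The union of independent determinantal samples from disjoint ground sets is determinantal. -/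
theorem exists_kernel_biUnion {α ι : Type*} [Fintype α] [DecidableEq α] [Fintype ι] [DecidableEq ι]
    (p : ι → Finset α → ℝ) (E : ι → Finset α) (h : ∀ i, IsHalfDeterminantal (p i) (E i))
    (hE : ∀ i j, i ≠ j → Disjoint (E i) (E j)) :
    ∃ K : Matrix α α ℝ, K.IsSymm ∧ (∀ e, ∑ f, K e f ^ 2 ≤ K e e) ∧
      (∀ i, ∀ e ∈ E i, K e e = 1 / 2) ∧
      ∀ (m : ℕ) (a : Fin m → α), Function.Injective a →
        ∑ ω : ι → Finset α, (∏ i, p i (ω i)) *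
            ∏ j, (if a j ∈ Finset.univ.biUnion ω then (-1 : ℝ) else 1) =
          (1 - (2 : ℝ) • K.submatrix a a).det := by
  choose K hKs hK hK2 hK0 hKd using fun i => (h i).kernel
  have hz : ∀ i, ∀ e ∉ E i, ∀ f, K i e f = 0 := fun i e he f =>
    kernel_eq_zero (hK i) (hK0 i e he) f
  have hz' : ∀ i, ∀ f ∉ E i, ∀ e, K i e f = 0 := fun i f hf e => by
    rw [← (hKs i).apply]
    exact hz i f hf e
  have hone : ∀ i, ∀ e ∈ E i, ∀ f, (∑ j, K j) e f = K i e f := by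
    intro i e he f
    rw [Matrix.sum_apply]
    refine Finset.sum_eq_single i (fun j _ hj => ?_) (by simp)
    exact hz j e (fun hej => Finset.disjoint_left.1 (hE j i hj) hej he) f
  refine ⟨∑ i, K i, ?_, fun e => ?_, fun i e he => ?_, fun m a ha => ?_⟩
  · ext e f
    rw [Matrix.transpose_apply, Matrix.sum_apply, Matrix.sum_apply]
    exact Finset.sum_congr rfl fun i _ => (hKs i).apply _ _
  · by_cases he : ∃ i, e ∈ E i
    · obtain ⟨i, hi⟩ := he
      simp only [hone i e hi]
      exact hK i e
    · push Not at he
      have : ∀ f, (∑ i, K i) e f = 0 := fun f => by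
        rw [Matrix.sum_apply]
        exact Finset.sum_eq_zero fun i _ => hz i e (he i) f
      simp [this]
  · rw [hone i e he]
    exact hK2 i e he
  · have hsub : ∀ ω : ι → Finset α, (∏ i, p i (ω i)) *
          ∏ j, (if a j ∈ Finset.univ.biUnion ω then (-1 : ℝ) else 1) =
        ∏ i, (p i (ω i) * ∏ j, (if a j ∈ ω i then (-1 : ℝ) else 1)) := by
      intro ω
      rw [Finset.prod_mul_distrib]
      -- For an outcome of nonzero weight the samples lie in disjoint ground sets, so each `a j` is
      -- in at most one of them and the signs multiply. Otherwise both sides vanish.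
      by_cases hω : ∀ i, p i (ω i) ≠ 0
      · congr 1
        rw [Finset.prod_comm]
        refine Finset.prod_congr rfl fun j _ => ?_
        by_cases hj : ∃ i, a j ∈ ω i
        · obtain ⟨i, hi⟩ := hj
          rw [if_pos (Finset.mem_biUnion.2 ⟨i, Finset.mem_univ i, hi⟩), Finset.prod_eq_single i]
          · rw [if_pos hi]
          · intro i' _ hi'
            rw [if_neg]
            intro hmem
            exact Finset.disjoint_left.1 (hE i' i hi') ((h i').support _ (hω i') hmem)
              ((h i).support _ (hω i) hi)
          · simp
        · rw [if_neg, Finset.prod_eq_one]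
          · exact fun i _ => if_neg fun hi => hj ⟨i, hi⟩
          · simpa using hj
      · push Not at hω
        obtain ⟨i, hi⟩ := hω
        rw [Finset.prod_eq_zero (Finset.mem_univ i) hi, zero_mul, zero_mul]
    -- The kernels live on disjoint blocks, so their mutual products vanish and `(1 - 2K)(1 - 2K') =
    -- 1 - 2(K + K')`.
    have hprod : ∀ s : Finset ι, ∏ i ∈ s, (1 - (2 : ℝ) • ((K i).submatrix a a)).det =
        (1 - (2 : ℝ) • (∑ i ∈ s, K i).submatrix a a).det := by
      intro s
      induction s using Finset.induction_on with
      | empty => simp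
      | insert i s hi ih =>
        rw [Finset.prod_insert hi, ih, ← Matrix.det_mul, Finset.sum_insert hi]
        congr 1
        have hzero : (K i).submatrix a a * (∑ i ∈ s, K i).submatrix a a = 0 := by
          ext b c
          rw [Matrix.mul_apply, Matrix.zero_apply]
          refine Finset.sum_eq_zero fun g _ => ?_
          by_cases hg : a g ∈ E i
          · rw [Matrix.submatrix_apply, Matrix.submatrix_apply, Matrix.sum_apply,
              Finset.sum_eq_zero, mul_zero]
            intro j hj
            exact hz j _ (fun hej => Finset.disjoint_left.1
              (hE j i (fun hji => hi (hji ▸ hj))) hej hg) _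
          · rw [Matrix.submatrix_apply, hz' i _ hg, zero_mul]
        rw [Matrix.submatrix_add, Pi.add_apply, Pi.add_apply, sub_mul, mul_sub, mul_sub]
        simp only [Matrix.smul_mul, Matrix.mul_smul, hzero, Matrix.one_mul, Matrix.mul_one,
          smul_zero, smul_add]
        abel
    rw [Finset.sum_congr rfl fun ω _ => hsub ω, ← hprod,
      ← Finset.prod_congr rfl fun i _ => hKd i m a ha, Finset.prod_univ_sum]
    exact Finset.sum_congr (by simp) fun _ _ => rfl

open Classical in
/-- In a determinantal random set with marginals `1 / 2`, two disjoint pairs are both split with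
probability at least `1 / 4`. -/
theorem quarter_le_split {α Ω : Type*} [Fintype α] [Fintype Ω] (μ : Ω → ℝ)
    (T : Ω → Finset α) (K : Matrix α α ℝ) (hKs : K.IsSymm) (hK : ∀ e, ∑ f, K e f ^ 2 ≤ K e e)
    (hKd : ∀ (m : ℕ) (a : Fin m → α), Function.Injective a →
      ∑ ω, μ ω * ∏ j, (if a j ∈ T ω then (-1 : ℝ) else 1) =
        (1 - (2 : ℝ) • K.submatrix a a).det)
    (a : Fin 4 → α) (ha : Function.Injective a) (hd : ∀ j, K (a j) (a j) = 1 / 2) :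
    1 / 4 ≤ ∑ ω, if Xor (a 0 ∈ T ω) (a 1 ∈ T ω) ∧ Xor (a 2 ∈ T ω) (a 3 ∈ T ω) then μ ω else 0 := by
  have hrow : ∀ i, ∑ j, K (a i) (a j) ^ 2 ≤ 1 / 2 := by
    intro i
    rw [← hd i]
    refine le_trans ?_ (hK (a i))
    rw [← Finset.sum_image (f := fun f => K (a i) f ^ 2) (s := Finset.univ) ha.injOn]
    exact Finset.sum_le_sum_of_subset_of_nonneg (Finset.subset_univ _) fun _ _ _ => sq_nonneg _
  have hsym : ∀ i j, K (a i) (a j) = K (a j) (a i) := fun i j => hKs.apply _ _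
  have h0 := hKd 0 (fun i => i.elim0) (fun i => i.elim0)
  have hpair : ∀ i j, i ≠ j →
      ∑ ω, μ ω * ((if a i ∈ T ω then (-1 : ℝ) else 1) * if a j ∈ T ω then -1 else 1) =
        -4 * K (a i) (a j) ^ 2 := by
    intro i j hij
    have h := hKd 2 ![a i, a j] (by
      intro k l hkl
      fin_cases k <;> fin_cases l <;> simp_all [ha.eq_iff])
    simp only [Fin.prod_univ_two] at h
    refine Eq.trans h ?_
    have hM : 1 - (2 : ℝ) • K.submatrix ![a i, a j] ![a i, a j] =
        !![0, -2 * K (a i) (a j); -2 * K (a i) (a j), 0] := by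
      ext k l
      rw [Matrix.sub_apply, Matrix.smul_apply, Matrix.submatrix_apply]
      fin_cases k <;> fin_cases l <;> simp [hd, hsym j i]
    rw [hM, Matrix.det_fin_two_of]
    ring
  have h01 := hpair 0 1 (by decide)
  have h23 := hpair 2 3 (by decide)
  have h4 := hKd 4 a ha
  simp only [Finset.univ_eq_empty, Finset.prod_empty, mul_one, Matrix.det_isEmpty] at h0
  simp only [Fin.prod_univ_four] at h4
  -- With `X j = -1` if `a j ∈ T` and `X j = 1` otherwise, the indicator of both splits is `(1 - X 0
  -- * X 1) * (1 - X 2 * X 3) / 4`.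
  have hexp : (∑ ω, if Xor (a 0 ∈ T ω) (a 1 ∈ T ω) ∧ Xor (a 2 ∈ T ω) (a 3 ∈ T ω) then μ ω else 0) =
      (∑ ω, μ ω - ∑ ω, μ ω * ((if a 0 ∈ T ω then (-1 : ℝ) else 1) * if a 1 ∈ T ω then -1 else 1)
        - ∑ ω, μ ω * ((if a 2 ∈ T ω then (-1 : ℝ) else 1) * if a 3 ∈ T ω then -1 else 1)
        + ∑ ω, μ ω * ((if a 0 ∈ T ω then (-1 : ℝ) else 1) * (if a 1 ∈ T ω then -1 else 1) *
          (if a 2 ∈ T ω then (-1 : ℝ) else 1) * if a 3 ∈ T ω then -1 else 1)) / 4 := by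
    rw [← Finset.sum_sub_distrib, ← Finset.sum_sub_distrib, ← Finset.sum_add_distrib,
      Finset.sum_div]
    refine Finset.sum_congr rfl fun ω _ => ?_
    by_cases h0 : a 0 ∈ T ω <;> by_cases h1 : a 1 ∈ T ω <;> by_cases h2 : a 2 ∈ T ω <;>
      by_cases h3 : a 3 ∈ T ω <;> simp [h0, h1, h2, h3, Xor] <;> ring
  rw [hexp, h0, h01, h23, h4]
  have hr0 := hrow 0
  have hr1 := hrow 1
  rw [Fin.sum_univ_four, hd] at hr0 hr1
  rw [hsym 1 0] at hr1
  have hdet : (1 - (2 : ℝ) • K.submatrix a a).det =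
      16 * ((K (a 0) (a 1) * K (a 2) (a 3)) ^ 2 +
        (K (a 0) (a 2) * K (a 1) (a 3) - K (a 0) (a 3) * K (a 1) (a 2)) ^ 2 -
        2 * (K (a 0) (a 1) * K (a 2) (a 3)) *
          (K (a 0) (a 2) * K (a 1) (a 3) + K (a 0) (a 3) * K (a 1) (a 2))) := by
    have hM : 1 - (2 : ℝ) • K.submatrix a a = (-2 : ℝ) •
        !![0, K (a 0) (a 1), K (a 0) (a 2), K (a 0) (a 3);
          K (a 0) (a 1), 0, K (a 1) (a 2), K (a 1) (a 3);
          K (a 0) (a 2), K (a 1) (a 2), 0, K (a 2) (a 3);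
          K (a 0) (a 3), K (a 1) (a 3), K (a 2) (a 3), 0] := by
      ext k l
      rw [Matrix.sub_apply, Matrix.smul_apply, Matrix.submatrix_apply]
      fin_cases k <;> fin_cases l <;>
        simp [hd, hsym 1 0, hsym 2 0, hsym 3 0, hsym 2 1, hsym 3 1, hsym 3 2]
    rw [hM, Matrix.det_smul, Matrix.det_succ_row_zero]
    simp [Fin.sum_univ_succ, Matrix.det_fin_three, Fin.succAbove]
    ring
  rw [hdet]
  generalize K (a 0) (a 1) = p at *
  generalize K (a 2) (a 3) = q at *
  generalize K (a 0) (a 2) = r at *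
  generalize K (a 0) (a 3) = s at *
  generalize K (a 1) (a 2) = t at *
  generalize K (a 1) (a 3) = u at *
  -- The diagonal entry takes 1/4 of the bound 1/2 in each row, so `p² + r² + s² ≤ 1/4` and `p² + t²
  -- + u² ≤ 1/4`. Then apply `2|ru| ≤ r² + u²` and `2|st| ≤ s² + t²`.
  have hab : |2 * (r * u + s * t)| ≤ 1 / 2 := by
    rw [abs_le]
    constructor <;>
      nlinarith [sq_nonneg (r + u), sq_nonneg (s + t), sq_nonneg (r - u), sq_nonneg (s - t),
        sq_nonneg p]
  have hpq : 2 * |p * q| ≤ p ^ 2 + q ^ 2 := by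
    rw [abs_mul]
    nlinarith [sq_nonneg (|p| - |q|), sq_abs p, sq_abs q]
  have hmul : p * q * (2 * (r * u + s * t)) ≤ |p * q| * (1 / 2) :=
    (le_abs_self _).trans ((abs_mul _ _).trans_le (by gcongr))
  -- Four times the probability is `1 + 4p² + 4q²` plus 16 times two squares, minus `32pq(ru + st)`.
  -- The last term is at most `8|pq| ≤ 4p² + 4q²`.
  nlinarith [sq_nonneg (p * q), sq_nonneg (r * u - s * t)]

/-! ### Incidence matrices and the matrix-tree theorem. -/

set_option linter.unusedSectionVars false

variable {V : Type*} [Fintype V] [DecidableEq V]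

theorem Joins.symm {e : Edge V} {X Y : Finset V} (h : Joins e X Y) : Joins e Y X := by
  obtain ⟨u, hu, v, hv, he⟩ := h
  exact ⟨v, hv, u, hu, he.trans Sym2.eq_swap⟩

open Classical in
/-- The oriented incidence matrix of the contracted graph `(A, E(A))` without the row of `X₀`. -/
noncomputable def incidence (G : Finset (Edge V)) (A : Finset (Finset V)) (X₀ : Finset V) :
    Matrix (A.erase X₀) (Edge V) ℤ :=
  Matrix.of fun Z e => if e ∈ innerEdges G A then
    (if e.1.out.1 ∈ Z.1 then 1 else 0) - (if e.1.out.2 ∈ Z.1 then 1 else 0) else 0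

theorem mem_innerEdges {G : Finset (Edge V)} {A : Finset (Finset V)} {e : Edge V} :
    e ∈ innerEdges G A ↔ e ∈ G ∧ ∃ X ∈ A, ∃ Y ∈ A, X ≠ Y ∧ Joins e X Y := by
  classical
  simp [innerEdges]

theorem mem_iff_eq_of_pairwiseDisjoint {A : Finset (Finset V)}
    (hA : (A : Set (Finset V)).PairwiseDisjoint id) {X Z : Finset V} (hX : X ∈ A) (hZ : Z ∈ A)
    {u : V} (hu : u ∈ X) : u ∈ Z ↔ Z = X := by
  constructor
  · intro h
    by_contra hne
    exact Finset.disjoint_left.1 (hA hZ hX hne) h hu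
  · rintro rfl
    exact hu

-- Every column is a difference of two node indicators. The sign `ε` absorbs the arbitrary
-- orientation that `Quot.out` gives to the edge.
open Classical in
theorem incidence_apply {G : Finset (Edge V)} {A : Finset (Finset V)} {X₀ : Finset V}
    (hA : (A : Set (Finset V)).PairwiseDisjoint id) {e : Edge V} (he : e ∈ innerEdges G A)
    {X Y : Finset V} (hX : X ∈ A) (hY : Y ∈ A) (h : Joins e X Y) :
    ∃ ε : ℤ, ε * ε = 1 ∧ ∀ Z : A.erase X₀, incidence G A X₀ Z e =
      ε * ((if Z.1 = X then 1 else 0) - (if Z.1 = Y then 1 else 0)) := by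
  obtain ⟨u, hu, v, hv, huv⟩ := h
  have hout : s(e.1.out.1, e.1.out.2) = s(u, v) := by
    rw [← huv]
    exact Quot.out_eq e.1
  have hZ : ∀ Z : A.erase X₀, Z.1 ∈ A := fun Z => Finset.mem_of_mem_erase Z.2
  rcases Sym2.eq_iff.1 hout with ⟨h1, h2⟩ | ⟨h1, h2⟩
  · refine ⟨1, by norm_num, fun Z => ?_⟩
    simp only [incidence, Matrix.of_apply, if_pos he, h1, h2,
      mem_iff_eq_of_pairwiseDisjoint hA hX (hZ Z) hu,
      mem_iff_eq_of_pairwiseDisjoint hA hY (hZ Z) hv, one_mul]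
  · refine ⟨-1, by norm_num, fun Z => ?_⟩
    simp only [incidence, Matrix.of_apply, if_pos he, h1, h2,
      mem_iff_eq_of_pairwiseDisjoint hA hX (hZ Z) hu,
      mem_iff_eq_of_pairwiseDisjoint hA hY (hZ Z) hv]
    ring

-- Following the tree path from `X₀` to `X` writes the unit vector of each node `X` as an integer
-- combination of columns; the path starts at 0 because the row of `X₀` is deleted. This gives an
-- integral right inverse, hence determinant ±1.
open Classical in
theorem isUnit_det_incidence {G : Finset (Edge V)} {A : Finset (Finset V)} {X₀ : Finset V}
    (hA : (A : Set (Finset V)).PairwiseDisjoint id) (hX₀ : X₀ ∈ A) {T : Finset (Edge V)}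
    (hT : IsSpanningTree G A T) (φ : A.erase X₀ → Edge V) (hφ : Finset.univ.image φ = T) :
    IsUnit ((incidence G A X₀).submatrix id φ).det := by
  obtain ⟨hTG, hconn, -⟩ := hT
  have key : ∀ X ∈ A, ∃ c : A.erase X₀ → ℤ, ∀ Z : A.erase X₀,
      ∑ i, incidence G A X₀ Z (φ i) * c i = if Z.1 = X then 1 else 0 := by
    intro X hX
    have hpath := hconn X₀ hX₀ X hX
    induction hpath with
    | refl =>
      refine ⟨0, fun Z => ?_⟩
      have : Z.1 ≠ X₀ := Finset.ne_of_mem_erase Z.2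
      simp [this]
    | @tail X' Y' _ h ih =>
      obtain ⟨hX', hY', e, heT, hJ⟩ := h
      obtain ⟨c, hc⟩ := ih hX'
      obtain ⟨i, -, hi⟩ := Finset.mem_image.1 (hφ.symm ▸ heT : e ∈ Finset.univ.image φ)
      obtain ⟨ε, hε, hB⟩ := incidence_apply (X₀ := X₀) hA (hTG heT) hX' hY' hJ
      -- The column of `e` is `ε` times the indicator of `X'` minus that of `Y'`. Since `ε * ε = 1`,
      -- subtracting `ε` times the column turns the first indicator into the second.
      refine ⟨c - Pi.single i ε, fun Z => ?_⟩
      simp only [Pi.sub_apply, mul_sub, Finset.sum_sub_distrib, hc]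
      rw [Finset.sum_eq_single i]
      · rw [Pi.single_eq_same, hi, hB Z, mul_right_comm, hε]
        ring
      · intro j _ hj
        rw [Pi.single_eq_of_ne hj, mul_zero]
      · simp
  have hmem : ∀ X : A.erase X₀, X.1 ∈ A := fun X => Finset.mem_of_mem_erase X.2
  choose c hc using fun X : A.erase X₀ => key X.1 (hmem X)
  refine Matrix.isUnit_det_of_right_inverse (B := Matrix.of fun i X => c X i) ?_
  ext Z X
  rw [Matrix.mul_apply, Matrix.one_apply]
  simp only [Matrix.submatrix_apply, id, Matrix.of_apply, hc, Subtype.ext_iff]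

-- An edge outside `E(A)` gives a zero column. Otherwise the number of edges is right, so failing to
-- be a tree means being disconnected; the indicator of the nodes unreachable from `X₀` is then a
-- nonzero vector in the left kernel.
open Classical in
theorem det_incidence_eq_zero {G : Finset (Edge V)} {A : Finset (Finset V)} {X₀ : Finset V}
    (hA : (A : Set (Finset V)).PairwiseDisjoint id) (hX₀ : X₀ ∈ A)
    (φ : A.erase X₀ → Edge V) (hφ : Function.Injective φ)
    (hT : ¬ IsSpanningTree G A (Finset.univ.image φ)) :
    ((incidence G A X₀).submatrix id φ).det = 0 := by
  by_cases hTG : Finset.univ.image φ ⊆ innerEdges G A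
  swap
  · obtain ⟨e, he, heG⟩ := Finset.not_subset.1 hTG
    obtain ⟨i, -, rfl⟩ := Finset.mem_image.1 he
    exact Matrix.det_eq_zero_of_column_eq_zero i fun Z => by simp [incidence, heG]
  have hcard : (Finset.univ.image φ).card + 1 = A.card := by
    rw [Finset.card_image_of_injective _ hφ, Finset.card_univ, Fintype.card_coe]
    exact Finset.card_erase_add_one hX₀
  set T := Finset.univ.image φ with hTdef
  set r : Finset V → Finset V → Prop :=
    fun X' Y' => X' ∈ A ∧ Y' ∈ A ∧ ∃ e ∈ T, Joins e X' Y' with hr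
  have hrs : Std.Symm r := ⟨fun X Y ⟨h1, h2, e, he, hJ⟩ => ⟨h2, h1, e, he, hJ.symm⟩⟩
  have hne : ∃ Y ∈ A, ¬ Relation.ReflTransGen r X₀ Y := by
    by_contra! hcon
    refine hT ⟨hTG, fun X hX Y hY => ?_, hcard⟩
    exact (Std.Symm.symm _ _ (hcon X hX)).trans (hcon Y hY)
  obtain ⟨Y, hY, hYr⟩ := hne
  have hYX : Y ≠ X₀ := fun h => hYr (h ▸ Relation.ReflTransGen.refl)
  rw [← Matrix.exists_vecMul_eq_zero_iff]
  refine ⟨fun Z => if Relation.ReflTransGen r X₀ Z.1 then 0 else 1, ?_, ?_⟩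
  · intro h
    have := congrFun h ⟨Y, Finset.mem_erase.2 ⟨hYX, hY⟩⟩
    simp [hYr] at this
  · ext i
    have hi : φ i ∈ T := Finset.mem_image_of_mem _ (Finset.mem_univ i)
    obtain ⟨-, X, hX, X', hX', hXX', hJ⟩ := mem_innerEdges.1 (hTG hi)
    obtain ⟨ε, -, hB⟩ := incidence_apply (X₀ := X₀) hA (hTG hi) hX hX' hJ
    have hiff : Relation.ReflTransGen r X₀ X ↔ Relation.ReflTransGen r X₀ X' :=
      ⟨fun h => h.tail ⟨hX, hX', _, hi, hJ⟩, fun h => h.tail ⟨hX', hX, _, hi, hJ.symm⟩⟩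
    have hsum : ∀ W ∈ A, ∑ Z : A.erase X₀, (if Relation.ReflTransGen r X₀ Z.1 then (0 : ℤ) else 1) *
        (if Z.1 = W then 1 else 0) = if Relation.ReflTransGen r X₀ W then 0 else 1 := by
      intro W hW
      by_cases hW0 : W = X₀
      · subst hW0
        rw [if_pos Relation.ReflTransGen.refl]
        refine Finset.sum_eq_zero fun Z _ => ?_
        rw [if_neg (Finset.ne_of_mem_erase Z.2), mul_zero]
      · rw [Finset.sum_eq_single ⟨W, Finset.mem_erase.2 ⟨hW0, hW⟩⟩]
        · simp
        · intro Z _ hZ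
          rw [if_neg (fun h => hZ (Subtype.ext h)), mul_zero]
        · simp
    rw [Matrix.vecMul, Pi.zero_apply, dotProduct]
    simp only [Matrix.submatrix_apply, id, hB, mul_left_comm _ ε, ← Finset.mul_sum, mul_sub,
      Finset.sum_sub_distrib, hsum X hX, hsum X' hX', hiff, sub_self]

/-- A spanning tree does not contain two parallel edges. -/
theorem IsSpanningTree.not_parallel {G : Finset (Edge V)} {A : Finset (Finset V)}
    (hA : (A : Set (Finset V)).PairwiseDisjoint id) {T : Finset (Edge V)}
    (hT : IsSpanningTree G A T) {a b : Edge V} (hab : a ≠ b) (ha : a ∈ T) (hb : b ∈ T)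
    {X Y : Finset V} (hX : X ∈ A) (hY : Y ∈ A) (hJa : Joins a X Y) (hJb : Joins b X Y) : False := by
  classical
  obtain ⟨ψ⟩ : Nonempty (A.erase X ≃ T) := by
    refine ⟨Fintype.equivOfCardEq ?_⟩
    rw [Fintype.card_coe, Fintype.card_coe]
    have := Finset.card_erase_add_one hX
    have := hT.2.2
    omega
  set φ : A.erase X → Edge V := fun i => (ψ i).1 with hφ
  have him : Finset.univ.image φ = T := by
    ext e
    simp only [Finset.mem_image, Finset.mem_univ, true_and, hφ]
    exact ⟨fun ⟨i, hi⟩ => hi ▸ (ψ i).2, fun he => ⟨ψ.symm ⟨e, he⟩, by simp⟩⟩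
  have hu := isUnit_det_incidence (G := G) hA hX hT φ him
  refine hu.ne_zero ?_
  obtain ⟨ε, hε, hB⟩ := incidence_apply (X₀ := X) hA (hT.1 ha) hX hY hJa
  obtain ⟨ε', hε', hB'⟩ := incidence_apply (X₀ := X) hA (hT.1 hb) hX hY hJb
  set i := ψ.symm ⟨a, ha⟩ with hi
  set j := ψ.symm ⟨b, hb⟩ with hj
  have hij : i ≠ j := by
    intro h
    have := ψ.symm.injective h
    exact hab (congrArg Subtype.val this)
  have hφi : φ i = a := by simp [hφ, hi]
  have hφj : φ j = b := by simp [hφ, hj]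
  rw [← Matrix.exists_mulVec_eq_zero_iff]
  -- The columns of parallel edges agree up to sign, so this vector is in the kernel of a matrix
  -- with unit determinant.
  refine ⟨Pi.single i ε - Pi.single j ε', ?_, ?_⟩
  · intro h
    have := congrFun h i
    simp [hij] at this
    simp [this] at hε
  · ext Z
    rw [Matrix.mulVec_sub]
    simp only [Matrix.mulVec_single, Pi.sub_apply, Pi.smul_apply, Matrix.col_apply,
      Matrix.submatrix_apply, id, hφi, hφj, hB, hB', Pi.zero_apply, MulOpposite.smul_eq_mul_unop,
      MulOpposite.unop_op]
    rw [mul_right_comm, hε, mul_right_comm, hε', sub_self]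

/-- The weighted matrix-tree theorem for the contracted graph `(A, E(A))`. -/
theorem det_gram_incidence {G : Finset (Edge V)} {A : Finset (Finset V)} {X₀ : Finset V}
    (hA : (A : Set (Finset V)).PairwiseDisjoint id) (hX₀ : X₀ ∈ A) (w : Edge V → ℝ) :
    open Classical in
    ((incidence G A X₀).map (Int.cast : ℤ → ℝ) * diagonal w *
      ((incidence G A X₀).map (Int.cast : ℤ → ℝ))ᵀ).det =
      ∑ T ∈ Finset.univ.filter (IsSpanningTree G A), ∏ e ∈ T, w e := by
  classical
  refine det_gram_eq_sum ((incidence G A X₀).map (Int.cast : ℤ → ℝ)) (IsSpanningTree G A) ?_ ?_ w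
  · intro T hT
    rw [Fintype.card_coe]
    have := Finset.card_erase_add_one hX₀
    have := hT.2.2
    omega
  · intro φ hφ
    have hmap : (((incidence G A X₀).map (Int.cast : ℤ → ℝ)).submatrix id φ).det =
        (((incidence G A X₀).submatrix id φ).det : ℝ) := by
      rw [Int.cast_det]
      rfl
    rw [hmap]
    split_ifs with hP
    · have hu := isUnit_det_incidence (G := G) hA hX₀ hP φ (by congr)
      rcases Int.isUnit_iff.1 hu with h | h <;> rw [h] <;> norm_num
    · rw [det_incidence_eq_zero hA hX₀ φ hφ (by convert hP)]
      norm_num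

/-- The kernel identity for `m = 0` says that the total mass is 1. For `m = 1` it identifies `K e e`
with the probability of `e`, so the marginals fix the diagonal. -/
theorem isHalfDeterminantal_of_det_gram {α n : Type*} [Fintype α] [DecidableEq α] [Fintype n]
    [DecidableEq n] (B : Matrix n α ℝ) (w : α → ℝ) (hw : ∀ e, 0 ≤ w e) (p : Finset α → ℝ)
    (hdet : (B * diagonal w * Bᵀ).det ≠ 0)
    (hp : ∀ s : α → ℝ, ∑ T, p T * ∏ e ∈ T, s e =
      (B * diagonal (fun e => s e * w e) * Bᵀ).det / (B * diagonal w * Bᵀ).det)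
    (E : Finset α) (hnonneg : ∀ T, 0 ≤ p T) (hsupp : ∀ T, p T ≠ 0 → T ⊆ E)
    (hmarg : ∀ e ∈ E, ∑ T ∈ Finset.univ.filter (fun T => e ∈ T), p T = 1 / 2) :
    IsHalfDeterminantal p E := by
  obtain ⟨K, hKs, hK, hKd⟩ := exists_kernel_of_det_gram B w hw p hdet hp
  have h0 : ∑ T, p T = 1 := by
    simpa using hKd 0 (fun i => i.elim0) (fun i => i.elim0)
  have h1 : ∀ e, ∑ T ∈ Finset.univ.filter (fun T => e ∈ T), p T = K e e := by
    intro e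
    have h := hKd 1 (fun _ => e) (fun _ _ _ => Subsingleton.elim _ _)
    simp only [Fin.prod_univ_one, Matrix.det_unique] at h
    have h2 : ∑ T, p T * (if e ∈ T then (-1 : ℝ) else 1) =
        ∑ T, p T - 2 * ∑ T ∈ Finset.univ.filter (fun T => e ∈ T), p T := by
      rw [Finset.sum_filter, Finset.mul_sum, ← Finset.sum_sub_distrib]
      refine Finset.sum_congr rfl fun T _ => ?_
      split_ifs <;> ring
    have h3 : ∑ T, p T * (if e ∈ T then (-1 : ℝ) else 1) = 1 - 2 * K e e := by
      rw [h]
      change (1 : Matrix (Fin 1) (Fin 1) ℝ) 0 0 - 2 * K e e = _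
      rw [Matrix.one_apply_eq]
    rw [h3, h0] at h2
    linarith
  refine ⟨hnonneg, hsupp, K, hKs, fun e => (hK e).le, fun e he => ?_, fun e he => ?_, ?_⟩
  · rw [← h1, hmarg e he]
  · rw [← h1]
    refine Finset.sum_eq_zero fun T hT => ?_
    by_contra h
    exact he (hsupp T h (Finset.mem_filter.1 hT).2)
  · exact hKd

/-- The maximum entropy distribution on spanning trees is determinantal. -/
theorem IsMaxEntropy.isHalfDeterminantal {G : Finset (Edge V)} {A : Finset (Finset V)}
    (hA : (A : Set (Finset V)).PairwiseDisjoint id) (hne : A.Nonempty) {p : Finset (Edge V) → ℝ}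
    (hp : IsMaxEntropy G A p) : IsHalfDeterminantal p (innerEdges G A) := by
  classical
  obtain ⟨⟨w, hw, hpos, hpw⟩, hmarg⟩ := hp
  obtain ⟨X₀, hX₀⟩ := hne
  have hdet := det_gram_incidence (G := G) hA hX₀
  have hpT : ∀ T, p T = if IsSpanningTree G A T then
      (∏ e ∈ T, w e) / ∑ T' ∈ Finset.univ.filter (IsSpanningTree G A), ∏ e ∈ T', w e else 0 := by
    intro T
    rw [hpw T]
  refine isHalfDeterminantal_of_det_gram ((incidence G A X₀).map (Int.cast : ℤ → ℝ)) w hw p ?_ ?_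
    _ ?_ ?_ ?_
  · have h := hdet w
    convert hpos.ne'
  · intro s
    have h1 := hdet w
    have h2 := hdet fun e => s e * w e
    have e1 : ∑ T, p T * ∏ e ∈ T, s e =
        (∑ T ∈ Finset.univ.filter (IsSpanningTree G A), ∏ e ∈ T, s e * w e) /
          ∑ T ∈ Finset.univ.filter (IsSpanningTree G A), ∏ e ∈ T, w e := by
      rw [Finset.sum_filter, Finset.sum_div]
      refine Finset.sum_congr rfl fun T _ => ?_
      rw [hpT T]
      split_ifs
      · rw [Finset.prod_mul_distrib]
        ring
      · simp
    rw [e1]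
    congr 1
    · exact h2.symm
    · exact h1.symm
  · intro T
    rw [hpw]
    split_ifs
    · exact div_nonneg (Finset.prod_nonneg fun e _ => hw e) hpos.le
    · exact le_rfl
  · intro T hT
    rw [hpw] at hT
    by_contra h
    exact hT (if_neg fun h' => h h'.1)
  · intro e he
    rw [← hmarg e he]

/-! ### Crossing minimum cuts force doubled edges. -/

section CutStructure

variable {α : Type*} [Fintype α] [DecidableEq α] {m : α → α → ℕ}

/-- The number of edges between `A` and `B` in the graph with `m x y` edges joining `x` and `y`. -/
def between (m : α → α → ℕ) (A B : Finset α) : ℕ := ∑ x ∈ A, ∑ y ∈ B, m x y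

theorem between_comm (hm : ∀ x y, m x y = m y x) (A B : Finset α) :
    between m A B = between m B A := by
  rw [between, Finset.sum_comm]
  exact Finset.sum_congr rfl fun x _ => Finset.sum_congr rfl fun y _ => hm _ _

theorem between_union_left {A B : Finset α} (h : Disjoint A B) (C : Finset α) :
    between m (A ∪ B) C = between m A C + between m B C :=
  Finset.sum_union h

theorem between_union_right (C : Finset α) {A B : Finset α} (h : Disjoint A B) :
    between m C (A ∪ B) = between m C A + between m C B := by
  simp only [between, Finset.sum_union h, Finset.sum_add_distrib]

theorem between_mono {A A' B B' : Finset α} (hA : A ⊆ A') (hB : B ⊆ B') :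
    between m A B ≤ between m A' B' :=
  (Finset.sum_le_sum fun _ _ => Finset.sum_le_sum_of_subset hB).trans
    (Finset.sum_le_sum_of_subset hA)

theorem between_singleton (x y : α) : between m {x} {y} = m x y := by
  simp [between]

theorem le_between {x y : α} {A : Finset α} (hy : y ∈ A) : m x y ≤ between m {x} A := by
  rw [← between_singleton (m := m) x y]
  exact between_mono le_rfl (Finset.singleton_subset_iff.2 hy)

/-- The degree of a corner of two sets. -/
theorem between_compl_of_partition {P Q R O : Finset α} (hPQ : Disjoint P Q) (hPR : Disjoint P R)
    (hPO : Disjoint P O) (hQR : Disjoint Q R) (hQO : Disjoint Q O) (hRO : Disjoint R O)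
    (h : P ∪ Q ∪ R ∪ O = Finset.univ) :
    between m P Pᶜ = between m P Q + between m P R + between m P O := by
  have : Pᶜ = Q ∪ R ∪ O := by
    ext x
    have h1 := Finset.mem_univ x
    rw [← h] at h1
    have h2 : x ∈ _ → x ∉ _ := fun hx => Finset.disjoint_left.1 hPQ hx
    have h3 : x ∈ _ → x ∉ _ := fun hx => Finset.disjoint_left.1 hPR hx
    have h4 : x ∈ _ → x ∉ _ := fun hx => Finset.disjoint_left.1 hPO hx
    simp only [Finset.mem_compl, Finset.mem_union] at *
    tauto
  rw [this, between_union_right _ (Finset.disjoint_union_left.2 ⟨hQO, hRO⟩),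
    between_union_right _ hQR]

theorem between_compl_of_partition₂ {P Q R O : Finset α} (hPQ : Disjoint P Q) (hPR : Disjoint P R)
    (hPO : Disjoint P O) (hQR : Disjoint Q R) (hQO : Disjoint Q O) (hRO : Disjoint R O)
    (h : P ∪ Q ∪ R ∪ O = Finset.univ) {A : Finset α} (hA : A = P ∪ Q) :
    between m A Aᶜ = between m P R + between m P O + between m Q R + between m Q O := by
  have : Aᶜ = R ∪ O := by
    subst hA
    ext x
    have h1 := Finset.mem_univ x
    rw [← h] at h1
    have h2 : x ∈ _ → x ∉ _ := fun hx => Finset.disjoint_left.1 hPO hx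
    have h3 : x ∈ _ → x ∉ _ := fun hx => Finset.disjoint_left.1 hPR hx
    have h4 : x ∈ _ → x ∉ _ := fun hx => Finset.disjoint_left.1 hQO hx
    have h5 : x ∈ _ → x ∉ _ := fun hx => Finset.disjoint_left.1 hQR hx
    simp only [Finset.mem_compl, Finset.mem_union] at *
    tauto
  rw [this, hA, between_union_right _ hRO, between_union_left hPQ, between_union_left hPQ]
  ring

/-- The four corners of two crossing minimum cuts form a cycle with doubled edges. -/
theorem corners_of_crossing (hm : ∀ x y, m x y = m y x)
    (hcut : ∀ A : Finset α, A.Nonempty → A ≠ Finset.univ → 4 ≤ between m A Aᶜ)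
    {A B : Finset α} (hA : between m A Aᶜ = 4) (hB : between m B Bᶜ = 4)
    (h1 : (A \ B).Nonempty) (h2 : (B \ A).Nonempty) (h3 : (A ∩ B).Nonempty)
    (h4 : ((A ∪ B)ᶜ).Nonempty) :
    between m (A ∩ B) (A ∩ B)ᶜ = 4 ∧ between m (A \ B) (A \ B)ᶜ = 4 ∧
      between m (A ∩ B) (A \ B) = 2 ∧ between m (A ∩ B) (B \ A) = 2 ∧
      between m (A \ B) (A ∪ B)ᶜ = 2 ∧ between m (A ∩ B) (A ∪ B)ᶜ = 0 ∧
      between m (A \ B) (B \ A) = 0 := by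
  have dPQ : Disjoint (A ∩ B) (A \ B) := by
    rw [Finset.disjoint_left]; intro x; simp; tauto
  have dPR : Disjoint (A ∩ B) (B \ A) := by
    rw [Finset.disjoint_left]; intro x; simp; tauto
  have dPO : Disjoint (A ∩ B) (A ∪ B)ᶜ := by
    rw [Finset.disjoint_left]; intro x; simp; tauto
  have dQR : Disjoint (A \ B) (B \ A) := by
    rw [Finset.disjoint_left]; intro x; simp; tauto
  have dQO : Disjoint (A \ B) (A ∪ B)ᶜ := by
    rw [Finset.disjoint_left]; intro x; simp; tauto
  have dRO : Disjoint (B \ A) (A ∪ B)ᶜ := by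
    rw [Finset.disjoint_left]; intro x; simp; tauto
  have hA' : A = (A ∩ B) ∪ (A \ B) := by ext x; simp; tauto
  have hB' : B = (A ∩ B) ∪ (B \ A) := by ext x; simp; tauto
  have ne_univ : ∀ {C D : Finset α}, Disjoint C D → D.Nonempty → C ≠ Finset.univ := by
    rintro C D hCD ⟨x, hx⟩ rfl
    exact Finset.disjoint_left.1 hCD (Finset.mem_univ x) hx
  have cP := hcut _ h3 (ne_univ dPQ h1)
  have cQ := hcut _ h1 (ne_univ dPQ.symm h3)
  have cR := hcut _ h2 (ne_univ dPR.symm h3)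
  have cO := hcut _ h4 (ne_univ dPO.symm h3)
  have hA4 := hA
  have hB4 := hB
  rw [between_compl_of_partition₂ (m := m) dPQ dPR dPO dQR dQO dRO
    (by ext x; simp; tauto) hA'] at hA4
  rw [between_compl_of_partition₂ (m := m) dPR dPQ dPO dQR.symm dRO dQO
    (by ext x; simp; tauto) hB'] at hB4
  have eP := between_compl_of_partition (m := m) dPQ dPR dPO dQR dQO dRO
    (by ext x; simp; tauto)
  have eQ := between_compl_of_partition (m := m) dPQ.symm dQR dQO dPR dPO dRO
    (by ext x; simp; tauto)
  have eR := between_compl_of_partition (m := m) dPR.symm dQR.symm dRO dPQ dPO dQO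
    (by ext x; simp; tauto)
  have eO := between_compl_of_partition (m := m) dPO.symm dQO.symm dRO.symm dPQ dPR dQR
    (by ext x; simp; tauto)
  have s1 := between_comm hm (A \ B) (A ∩ B)
  have s2 := between_comm hm (B \ A) (A ∩ B)
  have s3 := between_comm hm (A ∪ B)ᶜ (A ∩ B)
  have s4 := between_comm hm (B \ A) (A \ B)
  have s5 := between_comm hm (A ∪ B)ᶜ (A \ B)
  have s6 := between_comm hm (A ∪ B)ᶜ (B \ A)
  -- The two cut sizes sum to 8. This is also the sum of the cut sizes of either pair of opposite
  -- corners plus twice the number of edges between the other two corners. As corners have cuts of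
  -- size at least 4, the diagonals are empty and all corners are tight; the degree equations then
  -- force 2 on each side.
  omega

/-- Every proper minimum cut is crossed by a minimum cut. -/
def AllCrossed (m : α → α → ℕ) : Prop :=
  ∀ A : Finset α, 2 ≤ A.card → 2 ≤ Aᶜ.card → between m A Aᶜ = 4 →
    ∃ B : Finset α, between m B Bᶜ = 4 ∧ (A \ B).Nonempty ∧ (B \ A).Nonempty ∧
      (A ∩ B).Nonempty ∧ ((A ∪ B)ᶜ).Nonempty

/-- A cut `B` crossing `A` splits it into two smaller tight corners. As opposite corners are not
joined, `x` sends both its edges into the same one, and induction continues there until a single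
vertex remains. -/
theorem eq_zero_or_two_of_mem (hm : ∀ x y, m x y = m y x)
    (hcut : ∀ A : Finset α, A.Nonempty → A ≠ Finset.univ → 4 ≤ between m A Aᶜ)
    (hcross : AllCrossed m) {x : α} (A : Finset α) (hA : between m A Aᶜ = 4) (hx : x ∉ A)
    (hxA : between m {x} A = 2) : ∀ y ∈ A, m x y = 0 ∨ m x y = 2 := by
  induction hn : A.card using Nat.strong_induction_on generalizing A with
  | _ n ih =>
  subst hn
  intro y hy
  by_cases hc : 2 ≤ A.card
  swap
  · have : A.card = 1 := by
      have := Finset.card_pos.2 ⟨y, hy⟩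
      omega
    obtain ⟨z, rfl⟩ := Finset.card_eq_one.1 this
    rw [Finset.mem_singleton] at hy
    subst hy
    right
    rwa [between_singleton] at hxA
  · have hc' : 2 ≤ Aᶜ.card := by
      by_contra hlt
      -- In this case all four edges of the cut of `A` end at `x`, although only two edges join `x`
      -- to `A`.
      have hAc : Aᶜ = {x} := by
        refine (Finset.eq_of_subset_of_card_le (by simpa using hx) ?_).symm
        rw [Finset.card_singleton]
        omega
      rw [hAc, between_comm hm, hxA] at hA
      omega
    obtain ⟨B, hB, h1, h2, h3, h4⟩ := hcross A hc hc' hA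
    obtain ⟨t1, t2, -, -, -, e1, e2⟩ := corners_of_crossing hm hcut hA hB h1 h2 h3 h4
    have hsplit : between m {x} A = between m {x} (A ∩ B) + between m {x} (A \ B) := by
      rw [← between_union_right]
      · congr 1; ext z; simp; tauto
      · rw [Finset.disjoint_left]; intro z; simp; tauto
    have hlt1 : (A ∩ B).card < A.card := Finset.card_lt_card (by
      refine ⟨Finset.inter_subset_left, fun h => ?_⟩
      obtain ⟨z, hz⟩ := h1
      rw [Finset.mem_sdiff] at hz
      exact hz.2 (Finset.mem_inter.1 (h hz.1)).2)
    have hlt2 : (A \ B).card < A.card := Finset.card_lt_card (by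
      refine ⟨Finset.sdiff_subset, fun h => ?_⟩
      obtain ⟨z, hz⟩ := h3
      rw [Finset.mem_inter] at hz
      exact (Finset.mem_sdiff.1 (h hz.1)).2 hz.2)
    by_cases hxB : x ∈ B
    · have h0 : between m {x} (A \ B) = 0 := by
        rw [between_comm hm] at e2
        exact Nat.le_zero.1 (e2 ▸ between_mono (by simp [hx, hxB]) le_rfl)
      by_cases hyB : y ∈ B
      · exact ih _ hlt1 (A ∩ B) t1 (by simp [hx]) (by omega) rfl y (by simp [hy, hyB])
      · left
        exact Nat.le_zero.1 (h0 ▸ le_between (by simp [hy, hyB]))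
    · have h0 : between m {x} (A ∩ B) = 0 := by
        rw [between_comm hm] at e1
        exact Nat.le_zero.1 (e1 ▸ between_mono (by simp [hx, hxB]) le_rfl)
      by_cases hyB : y ∈ B
      · left
        exact Nat.le_zero.1 (h0 ▸ le_between (by simp [hy, hyB]))
      · exact ih _ hlt2 (A \ B) t2 (by simp [hx]) (by omega) rfl y (by simp [hy, hyB])

/-- Shrink `A` to its corner containing `x` until that corner is `{x}`. Then two edges at `x` go to
the other corner `Q` and the remaining two to `Aᶜ`. Both sets are tight, and `eq_zero_or_two_of_mem`
applies to the one that contains `y`. -/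
theorem eq_zero_or_two_of_proper (hm : ∀ x y, m x y = m y x)
    (hcut : ∀ A : Finset α, A.Nonempty → A ≠ Finset.univ → 4 ≤ between m A Aᶜ)
    (hcross : AllCrossed m) {x y : α} (hxy : y ≠ x) (A : Finset α) (hA : between m A Aᶜ = 4)
    (hx : x ∈ A) (h2 : 2 ≤ A.card) (hc2 : 2 ≤ Aᶜ.card) : m x y = 0 ∨ m x y = 2 := by
  induction hn : A.card using Nat.strong_induction_on generalizing A with
  | _ n ih =>
  subst hn
  have hAc : between m Aᶜ Aᶜᶜ = 4 := by rw [compl_compl, between_comm hm, hA]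
  have step : ∀ P Q : Finset α, P ∪ Q = A → Disjoint P Q → Q.Nonempty → x ∈ P →
      between m P Pᶜ = 4 → between m Q Qᶜ = 4 → between m P Q = 2 → m x y = 0 ∨ m x y = 2 := by
    rintro P Q hPQ hd ⟨q, hq⟩ hxP hP hQ hb
    by_cases hcP : 2 ≤ P.card
    · refine ih P.card (Finset.card_lt_card ⟨hPQ ▸ Finset.subset_union_left, fun h => ?_⟩) P hP
        hxP hcP (hc2.trans (Finset.card_le_card ?_)) rfl
      · exact Finset.disjoint_left.1 hd (h (hPQ ▸ Finset.mem_union_right _ hq)) hq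
      · exact Finset.compl_subset_compl.2 (hPQ ▸ Finset.subset_union_left)
    · have hPx : P = {x} := by
        refine (Finset.eq_of_subset_of_card_le (by simpa using hxP) ?_).symm
        rw [Finset.card_singleton]
        omega
      subst hPx
      by_cases hyA : y ∈ A
      · refine eq_zero_or_two_of_mem hm hcut hcross Q hQ (by simpa using hd) hb y ?_
        rw [← hPQ] at hyA
        simpa [hxy] using hyA
      · refine eq_zero_or_two_of_mem hm hcut hcross Aᶜ hAc (by simpa using hx) ?_ y
          (by simpa using hyA)
        have hu : ({x} : Finset α)ᶜ = Q ∪ Aᶜ := by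
          ext z
          have : z ∈ ({x} : Finset α) → z ∉ Q := fun hz => Finset.disjoint_left.1 hd hz
          rw [← hPQ]
          simp only [Finset.mem_compl, Finset.mem_union, Finset.mem_singleton] at *
          tauto
        have hd' : Disjoint Q Aᶜ := by
          rw [Finset.disjoint_left]
          intro z hz
          rw [← hPQ]
          simp [hz]
        rw [hu, between_union_right _ hd'] at hP
        omega
  obtain ⟨B, hB, h1, h2', h3, h4⟩ := hcross A h2 hc2 hA
  obtain ⟨t1, t2, e, -⟩ := corners_of_crossing hm hcut hA hB h1 h2' h3 h4
  have hd : Disjoint (A ∩ B) (A \ B) := by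
    rw [Finset.disjoint_left]; intro z; simp; tauto
  by_cases hxB : x ∈ B
  · exact step (A ∩ B) (A \ B) (by ext z; simp; tauto) hd h1 (by simp [hx, hxB]) t1 t2 e
  · exact step (A \ B) (A ∩ B) (by ext z; simp; tauto) hd.symm h3 (by simp [hx, hxB]) t2 t1
      (by rw [between_comm hm, e])

/-- If every proper minimum cut is crossed by a minimum cut, and there is a proper minimum cut or
the graph is a triangle, then all edges are doubled. -/
theorem eq_zero_or_two (hm : ∀ x y, m x y = m y x)
    (hdeg : ∀ x, between m {x} {x}ᶜ = 4)
    (hcut : ∀ A : Finset α, A.Nonempty → A ≠ Finset.univ → 4 ≤ between m A Aᶜ)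
    (hcross : AllCrossed m)
    (h : Fintype.card α = 3 ∨
      ∃ A : Finset α, 2 ≤ A.card ∧ 2 ≤ Aᶜ.card ∧ between m A Aᶜ = 4)
    {x y : α} (hxy : x ≠ y) : m x y = 0 ∨ m x y = 2 := by
  rcases h with h | ⟨A, h1, h2, h3⟩
  · have hcard : (({x, y} : Finset α)ᶜ).card = 1 := by
      rw [Finset.card_compl, Finset.card_pair hxy, h]
    obtain ⟨z, hz⟩ := Finset.card_eq_one.1 hcard
    have hzm : ∀ t, (t ≠ x ∧ t ≠ y) ↔ t = z := by
      intro t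
      have := Finset.ext_iff.1 hz t
      simpa using this
    have hzx := ((hzm z).2 rfl).1
    have hzy := ((hzm z).2 rfl).2
    have c1 : ({x} : Finset α)ᶜ = {y, z} := by
      ext t; have := hzm t; by_cases t = y <;> simp_all
      rintro rfl; exact hxy rfl
    have c2 : ({y} : Finset α)ᶜ = {x, z} := by
      ext t; have := hzm t; by_cases t = x <;> simp_all
    have c3 : ({z} : Finset α)ᶜ = {x, y} := by
      ext t; have := hzm t; by_cases t = x <;> by_cases t = y <;> simp_all
    have d1 := hdeg x
    have d2 := hdeg y
    have d3 := hdeg z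
    rw [c1, between, Finset.sum_singleton, Finset.sum_pair hzy.symm] at d1
    rw [c2, between, Finset.sum_singleton, Finset.sum_pair hzx.symm] at d2
    rw [c3, between, Finset.sum_singleton, Finset.sum_pair hxy] at d3
    have := hm x y
    have := hm x z
    have := hm y z
    -- In a triangle with all degrees 4, the three degree equations make every multiplicity 2.
    omega
  · by_cases hx : x ∈ A
    · exact eq_zero_or_two_of_proper hm hcut hcross hxy.symm A h3 hx h1 h2
    · exact eq_zero_or_two_of_proper hm hcut hcross hxy.symm Aᶜ
        (by rw [compl_compl, between_comm hm, h3]) (by simpa using hx) h2 (by rwa [compl_compl])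

end CutStructure

/-! ### Cuts of the support graph. -/

open Classical in
/-- The edges of `G` between `X` and `Y`. -/
noncomputable def joinEdges (G : Finset (Edge V)) (X Y : Finset V) : Finset (Edge V) :=
  G.filter fun e => Joins e X Y

theorem mem_joinEdges {G : Finset (Edge V)} {X Y : Finset V} {e : Edge V} :
    e ∈ joinEdges G X Y ↔ e ∈ G ∧ Joins e X Y := by
  simp [joinEdges]

theorem mem_cut {G : Finset (Edge V)} {X : Finset V} {e : Edge V} :
    e ∈ cut G X ↔ e ∈ G ∧ Joins e X Xᶜ := by
  simp [cut]

theorem joinEdges_comm (G : Finset (Edge V)) (X Y : Finset V) :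
    joinEdges G X Y = joinEdges G Y X := by
  ext e
  simp only [mem_joinEdges]
  exact ⟨fun h => ⟨h.1, h.2.symm⟩, fun h => ⟨h.1, h.2.symm⟩⟩

theorem mem_verts {A : Finset (Finset V)} {v : V} : v ∈ verts A ↔ ∃ X ∈ A, v ∈ X := by
  simp [verts]

/-- The number of edges of `G` with end points `u` and `v`. -/
def mult (G : Finset (Edge V)) (u v : V) : ℕ := (G.filter fun e => e.1 = s(u, v)).card

theorem mult_comm (G : Finset (Edge V)) (u v : V) : mult G u v = mult G v u := by
  simp only [mult, Sym2.eq_swap]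

/-- Disjointness ensures that no edge is counted once for each order of its end points. -/
theorem card_joinEdges (G : Finset (Edge V)) {X Y : Finset V} (h : Disjoint X Y) :
    (joinEdges G X Y).card = between (mult G) X Y := by
  have hU : joinEdges G X Y =
      (X ×ˢ Y).biUnion fun p => G.filter fun e => e.1 = s(p.1, p.2) := by
    ext e
    simp only [mem_joinEdges, Joins, Finset.mem_biUnion, Finset.mem_product, Finset.mem_filter,
      Prod.exists]
    constructor
    · rintro ⟨he, u, hu, v, hv, huv⟩
      exact ⟨u, v, ⟨hu, hv⟩, he, huv⟩
    · rintro ⟨u, v, ⟨hu, hv⟩, he, huv⟩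
      exact ⟨he, u, hu, v, hv, huv⟩
  rw [hU, Finset.card_biUnion, Finset.sum_product]
  · rfl
  · rintro ⟨u, v⟩ huv ⟨u', v'⟩ huv' hne
    rw [Finset.mem_coe, Finset.mem_product] at huv huv'
    change Disjoint (Finset.filter _ _) (Finset.filter _ _)
    rw [Finset.disjoint_filter]
    intro e _ h1 h2
    rw [h1] at h2
    rcases Sym2.eq_iff.1 h2 with ⟨h3, h4⟩ | ⟨h3, h4⟩
    · exact hne (Prod.ext h3 h4)
    · exact Finset.disjoint_left.1 h huv.1 (h3 ▸ huv'.2)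

theorem cut_eq_joinEdges (G : Finset (Edge V)) (X : Finset V) : cut G X = joinEdges G X Xᶜ := by
  ext e
  rw [mem_cut, mem_joinEdges]

theorem card_cut (G : Finset (Edge V)) (X : Finset V) :
    (cut G X).card = between (mult G) X Xᶜ := by
  rw [cut_eq_joinEdges, card_joinEdges G disjoint_compl_right]

theorem cut_compl (G : Finset (Edge V)) (X : Finset V) : cut G Xᶜ = cut G X := by
  rw [cut_eq_joinEdges, cut_eq_joinEdges, compl_compl, joinEdges_comm]

section Support

variable {x : Sym2 V → ℝ}

theorem mem_supportGraph {e : Edge V} :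
    e ∈ supportGraph x ↔ ((e.2 : ℕ) : ℝ) + 1 ≤ 2 * x e.1 := by
  simp [supportGraph]

theorem mult_supportGraph (hx : IsHalfIntegralSubtour x) (u v : V) :
    (mult (supportGraph x) u v : ℝ) = 2 * x s(u, v) := by
  have h : (supportGraph x).filter (fun e => e.1 = s(u, v)) =
      ((Finset.univ : Finset (Fin 2)).filter fun i : Fin 2 => ((i : ℕ) : ℝ) + 1 ≤ 2 * x s(u, v)).map
        ⟨fun i => (s(u, v), i), fun i j h => congrArg Prod.snd h⟩ := by
    ext ⟨p, i⟩
    simp only [Finset.mem_filter, mem_supportGraph, Finset.mem_map, Finset.mem_univ, true_and]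
    constructor
    · rintro ⟨h, rfl⟩
      exact ⟨i, h, rfl⟩
    · rintro ⟨j, h, hj⟩
      obtain ⟨rfl, rfl⟩ := Prod.mk.inj hj
      exact ⟨h, rfl⟩
  rw [mult, h, Finset.card_map]
  rcases hx.half_integral s(u, v) with h0 | h0 | h0 <;> rw [h0]
  · have : (Finset.univ : Finset (Fin 2)).filter (fun i : Fin 2 => ((i : ℕ) : ℝ) + 1 ≤ 2 * 0) = ∅ := by
      ext i; fin_cases i <;> simp
    rw [this]; simp
  · have : (Finset.univ : Finset (Fin 2)).filter (fun i : Fin 2 => ((i : ℕ) : ℝ) + 1 ≤ 2 * (1 / 2)) =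
        {0} := by
      ext i; fin_cases i <;> simp
    rw [this]; simp
  · have : (Finset.univ : Finset (Fin 2)).filter (fun i : Fin 2 => ((i : ℕ) : ℝ) + 1 ≤ 2 * 1) =
        Finset.univ := by
      ext i; fin_cases i <;> simp; norm_num
    rw [this]; simp

theorem between_supportGraph (hx : IsHalfIntegralSubtour x) (X Y : Finset V) :
    (between (mult (supportGraph x)) X Y : ℝ) = 2 * ∑ u ∈ X, ∑ v ∈ Y, x s(u, v) := by
  simp only [between, Nat.cast_sum, mult_supportGraph hx, Finset.mul_sum]

theorem four_le_card_cut (hx : IsHalfIntegralSubtour x) (S : Finset V) (h : S.Nonempty)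
    (h' : S ≠ Finset.univ) : 4 ≤ (cut (supportGraph x) S).card := by
  rw [card_cut]
  have h1 := hx.subtour S h h'
  have h2 := between_supportGraph hx S Sᶜ
  have : (4 : ℝ) ≤ between (mult (supportGraph x)) S Sᶜ := by rw [h2]; linarith
  exact_mod_cast this

theorem card_cut_singleton (hx : IsHalfIntegralSubtour x) (u : V) :
    (cut (supportGraph x) {u}).card = 4 := by
  rw [card_cut]
  have h1 := hx.degree u
  have h2 := between_supportGraph hx {u} {u}ᶜ
  rw [Finset.sum_singleton] at h2
  have h3 := Finset.sum_add_sum_compl {u} fun v => x s(u, v)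
  rw [Finset.sum_singleton, hx.loopless, zero_add] at h3
  rw [h3, h1] at h2
  have : (between (mult (supportGraph x)) {u} {u}ᶜ : ℝ) = 4 := by rw [h2]; norm_num
  exact_mod_cast this

/-- The values at `u` sum to 2 and each is at most 1, so `u` has at least two neighbours. -/
theorem three_le_card (hx : IsHalfIntegralSubtour x) (u : V) : 3 ≤ Fintype.card V := by
  have h1 := hx.degree u
  rw [← Finset.add_sum_erase _ _ (Finset.mem_univ u), hx.loopless, zero_add] at h1
  have h2 : ∑ v ∈ Finset.univ.erase u, x s(u, v) ≤ ∑ v ∈ Finset.univ.erase u, (1 : ℝ) := by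
    refine Finset.sum_le_sum fun v _ => ?_
    rcases hx.half_integral s(u, v) with h | h | h <;> rw [h] <;> norm_num
  rw [h1, Finset.sum_const, Finset.card_erase_of_mem (Finset.mem_univ u), Finset.card_univ,
    nsmul_eq_mul, mul_one] at h2
  have h3 : 2 ≤ Fintype.card V - 1 := by exact_mod_cast h2
  omega

end Support

/-! ### Contractions as partitions into nodes. -/

/-- `P` is the node set of a contraction of `G` in which every node has degree `4`. -/
structure IsContraction (G : Finset (Edge V)) (P : Finset (Finset V)) : Prop where
  disjoint : (P : Set (Finset V)).PairwiseDisjoint id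
  nonempty : ∀ X ∈ P, X.Nonempty
  cover : ∀ v, ∃ X ∈ P, v ∈ X
  card_cut : ∀ X ∈ P, (cut G X).card = 4

namespace IsContraction

variable {G : Finset (Edge V)} {P : Finset (Finset V)}

theorem verts_sdiff (hP : IsContraction G P) {A : Finset (Finset V)} (hA : A ⊆ P) :
    verts (P \ A) = (verts A)ᶜ := by
  ext v
  rw [Finset.mem_compl, mem_verts, mem_verts]
  constructor
  · rintro ⟨X, hX, hv⟩ ⟨Y, hY, hv'⟩
    rw [Finset.mem_sdiff] at hX
    have := (mem_iff_eq_of_pairwiseDisjoint hP.disjoint hX.1 (hA hY) hv).1 hv'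
    exact hX.2 (this ▸ hY)
  · intro h
    obtain ⟨X, hX, hv⟩ := hP.cover v
    exact ⟨X, Finset.mem_sdiff.2 ⟨hX, fun hXA => h ⟨X, hXA, hv⟩⟩, hv⟩

theorem disjoint_of_ne (hP : IsContraction G P) {X Y : Finset V} (hX : X ∈ P) (hY : Y ∈ P)
    (h : X ≠ Y) : Disjoint X Y :=
  hP.disjoint hX hY h

theorem verts_nonempty (hP : IsContraction G P) {A : Finset (Finset V)} (hA : A ⊆ P)
    (h : A.Nonempty) : (verts A).Nonempty := by
  obtain ⟨X, hX⟩ := h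
  obtain ⟨v, hv⟩ := hP.nonempty X (hA hX)
  exact ⟨v, mem_verts.2 ⟨X, hX, hv⟩⟩

theorem verts_ne_univ (hP : IsContraction G P) {A : Finset (Finset V)} (hA : A ⊆ P)
    (h : (P \ A).Nonempty) : verts A ≠ Finset.univ := by
  intro hu
  have h1 := hP.verts_nonempty (Finset.sdiff_subset (s := P) (t := A)) h
  rw [hP.verts_sdiff hA, hu, Finset.compl_univ] at h1
  exact Finset.not_nonempty_empty h1

/-- This lets the nodes serve as the vertices of the abstract graph in the results on crossing cuts.
-/
theorem between_verts (hP : IsContraction G P) (A B : Finset P) :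
    between (fun X Y : P => between (mult G) X.1 Y.1) A B =
      between (mult G) (verts (A.image Subtype.val)) (verts (B.image Subtype.val)) := by
  have hd : ∀ C : Finset P, Set.PairwiseDisjoint (C : Set P) (fun X : P => X.1) :=
    fun C X _ Y _ h => hP.disjoint_of_ne X.2 Y.2 fun h' => h (Subtype.ext h')
  have hv : ∀ C : Finset P, verts (C.image Subtype.val) = C.biUnion fun X => X.1 := by
    intro C
    ext v
    simp [mem_verts]
  rw [hv, hv, between, between, Finset.sum_biUnion (hd A)]
  refine Finset.sum_congr rfl fun X _ => ?_
  simp only [Finset.sum_biUnion (hd B)]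
  rw [Finset.sum_comm]
  simp only [between]

theorem image_compl (A : Finset P) :
    Aᶜ.image Subtype.val = P \ A.image Subtype.val := by
  ext X
  simp only [Finset.mem_image, Finset.mem_compl, Subtype.exists, exists_and_right, exists_eq_right,
    Finset.mem_sdiff, not_exists]
  constructor
  · rintro ⟨hX, h⟩
    exact ⟨hX, fun _ => h⟩
  · rintro ⟨hX, h⟩
    exact ⟨hX, h hX⟩

theorem between_compl (hP : IsContraction G P) (A : Finset P) :
    between (fun X Y : P => between (mult G) X.1 Y.1) A Aᶜ =
      (cut G (verts (A.image Subtype.val))).card := by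
  have hsub : A.image Subtype.val ⊆ P := by
    intro X hX
    obtain ⟨Y, -, rfl⟩ := Finset.mem_image.1 hX
    exact Y.2
  rw [hP.between_verts, image_compl, hP.verts_sdiff hsub, HalfIntegralTSP.card_cut]

/-- In a contraction all of whose proper tight sets are crossed, and that is a triangle or has a
proper tight set, two nodes are joined by no edge or by two parallel edges. -/
theorem card_joinEdges_eq (hP : IsContraction G P)
    (hG : ∀ S : Finset V, S.Nonempty → S ≠ Finset.univ → 4 ≤ (cut G S).card)
    (hcross : ∀ A, ¬ IsUncrossed G P A)
    (h : P.card = 3 ∨ ∃ A, IsProper P A ∧ IsTight G A)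
    {X Y : Finset V} (hX : X ∈ P) (hY : Y ∈ P) (hXY : X ≠ Y) :
    (joinEdges G X Y).card = 0 ∨ (joinEdges G X Y).card = 2 := by
  have hsub : ∀ A : Finset P, A.image Subtype.val ⊆ P := by
    intro A X hX
    obtain ⟨Y, -, rfl⟩ := Finset.mem_image.1 hX
    exact Y.2
  have hinj : Function.Injective (Subtype.val : P → Finset V) := Subtype.val_injective
  have hlift : ∀ B ⊆ P, ∃ B' : Finset P, B'.image Subtype.val = B := by
    intro B hB
    refine ⟨B.subtype (· ∈ P), ?_⟩
    ext Z
    simp only [Finset.mem_image, Finset.mem_subtype, Subtype.exists, exists_and_left,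
      exists_prop, exists_eq_right_right]
    exact ⟨fun h => h.1, fun h => ⟨h, hB h⟩⟩
  rw [card_joinEdges G (hP.disjoint_of_ne hX hY hXY)]
  refine eq_zero_or_two (m := fun X Y : P => between (mult G) X.1 Y.1) (x := ⟨X, hX⟩)
    (y := ⟨Y, hY⟩) (fun _ _ => between_comm (mult_comm G) _ _) ?_ ?_ ?_ ?_ ?_
  · intro Z
    rw [hP.between_compl, ← hP.card_cut Z.1 Z.2]
    simp [verts]
  · intro A hA hA'
    rw [hP.between_compl]
    refine hG _ (hP.verts_nonempty (hsub A) (hA.image _)) (hP.verts_ne_univ (hsub A) ?_)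
    rw [← image_compl, Finset.image_nonempty, Finset.nonempty_iff_ne_empty]
    simpa using hA'
  · intro A h1 h2 h3
    rw [hP.between_compl] at h3
    have hprop : IsProper P (A.image Subtype.val) := by
      refine ⟨hsub A, ?_, ?_⟩
      · rwa [Finset.card_image_of_injective _ hinj]
      · rwa [← image_compl, Finset.card_image_of_injective _ hinj]
    have hnot := hcross (A.image Subtype.val)
    have hex : ∃ B ⊆ P, IsTight G B ∧ Crosses P (A.image Subtype.val) B := by
      by_contra hcon
      push Not at hcon
      exact hnot ⟨hprop, h3, hcon⟩
    obtain ⟨B, hB, hBt, c1, c2, c3, c4⟩ := hex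
    obtain ⟨B', rfl⟩ := hlift B hB
    refine ⟨B', (hP.between_compl B').trans hBt, ?_, ?_, ?_, ?_⟩
    · rwa [← Finset.image_sdiff _ _ hinj, Finset.image_nonempty] at c1
    · rwa [← Finset.image_sdiff _ _ hinj, Finset.image_nonempty] at c2
    · rwa [← Finset.image_inter _ _ hinj, Finset.image_nonempty] at c3
    · rwa [← Finset.image_union, ← image_compl, Finset.image_nonempty] at c4
  · rcases h with h | ⟨A, hA, hAt⟩
    · left
      rw [Fintype.card_coe, h]
    · right
      obtain ⟨A', rfl⟩ := hlift A hA.1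
      obtain ⟨-, h1, h2⟩ := hA
      refine ⟨A', ?_, ?_, (hP.between_compl A').trans hAt⟩
      · rwa [Finset.card_image_of_injective _ hinj] at h1
      · rwa [← image_compl, Finset.card_image_of_injective _ hinj] at h2
  · exact fun h => hXY (congrArg Subtype.val h)

end IsContraction

theorem joins_exists {P : Finset (Finset V)} (hP : ∀ v, ∃ X ∈ P, v ∈ X) (e : Edge V) :
    ∃ X ∈ P, ∃ Y ∈ P, Joins e X Y := by
  obtain ⟨p, i⟩ := e
  induction p using Sym2.ind with
  | _ u v =>
    obtain ⟨X, hX, hu⟩ := hP u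
    obtain ⟨Y, hY, hv⟩ := hP v
    exact ⟨X, hX, Y, hY, u, hu, v, hv, rfl⟩

theorem Joins.mono {e : Edge V} {X Y X' Y' : Finset V} (h : Joins e X Y) (hX : X ⊆ X')
    (hY : Y ⊆ Y') : Joins e X' Y' := by
  obtain ⟨u, hu, v, hv, he⟩ := h
  exact ⟨u, hX hu, v, hY hv, he⟩

theorem Joins.not_self {e : Edge V} {X Y Z : Finset V} (h : Joins e X Y)
    (hZ : Joins e Z Z) (hd : Disjoint X Z ∨ Disjoint Y Z) : False := by
  obtain ⟨u, hu, v, hv, he⟩ := h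
  obtain ⟨u', hu', v', hv', he'⟩ := hZ
  rw [he] at he'
  rcases Sym2.eq_iff.1 he' with ⟨rfl, rfl⟩ | ⟨rfl, rfl⟩ <;> rcases hd with hd | hd
  · exact Finset.disjoint_left.1 hd hu hu'
  · exact Finset.disjoint_left.1 hd hv hv'
  · exact Finset.disjoint_left.1 hd hu hv'
  · exact Finset.disjoint_left.1 hd hv hu'

theorem verts_mono {A B : Finset (Finset V)} (h : A ⊆ B) : verts A ⊆ verts B :=
  Finset.biUnion_subset_biUnion_of_subset_left _ h

theorem subset_verts {A : Finset (Finset V)} {X : Finset V} (h : X ∈ A) : X ⊆ verts A :=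
  fun _ hv => mem_verts.2 ⟨X, h, hv⟩

namespace IsContraction

variable {G : Finset (Edge V)} {P : Finset (Finset V)}

theorem disjoint_verts (hP : IsContraction G P) {A : Finset (Finset V)} (hA : A ⊆ P)
    {X : Finset V} (hX : X ∈ P) (hXA : X ∉ A) : Disjoint X (verts A) := by
  rw [Finset.disjoint_left]
  intro v hv hvA
  obtain ⟨Y, hY, hvY⟩ := mem_verts.1 hvA
  exact hXA ((mem_iff_eq_of_pairwiseDisjoint hP.disjoint hX (hA hY) hv).1 hvY ▸ hY)

/-- Contracting a tight set. -/
theorem contract (hP : IsContraction G P) {A : Finset (Finset V)} (hA : A ⊆ P)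
    (hne : A.Nonempty) (ht : IsTight G A) : IsContraction G (insert (verts A) (P \ A)) := by
  refine ⟨?_, ?_, fun v => ?_, ?_⟩
  · have key : ∀ X ∈ P \ A, Disjoint X (verts A) := fun X hX =>
      hP.disjoint_verts hA (Finset.mem_sdiff.1 hX).1 (Finset.mem_sdiff.1 hX).2
    intro X hX Y hY hXY
    rw [Finset.mem_coe, Finset.mem_insert] at hX hY
    rcases hX with rfl | hX <;> rcases hY with rfl | hY
    · exact absurd rfl hXY
    · exact (key Y hY).symm
    · exact key X hX
    · exact hP.disjoint (Finset.mem_sdiff.1 hX).1 (Finset.mem_sdiff.1 hY).1 hXY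
  · intro X hX
    rcases Finset.mem_insert.1 hX with rfl | hX
    · exact hP.verts_nonempty hA hne
    · exact hP.nonempty X (Finset.mem_sdiff.1 hX).1
  · obtain ⟨X, hX, hv⟩ := hP.cover v
    by_cases hXA : X ∈ A
    · exact ⟨_, Finset.mem_insert_self _ _, subset_verts hXA hv⟩
    · exact ⟨X, Finset.mem_insert_of_mem (Finset.mem_sdiff.2 ⟨hX, hXA⟩), hv⟩
  · intro X hX
    rcases Finset.mem_insert.1 hX with rfl | hX
    · exact ht
    · exact hP.card_cut X (Finset.mem_sdiff.1 hX).1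

/-- Contracting the complement of a tight set. -/
theorem contract_compl (hP : IsContraction G P) {A : Finset (Finset V)} (hA : A ⊆ P)
    (hne : (P \ A).Nonempty) (ht : IsTight G A) : IsContraction G (insert (verts A)ᶜ A) := by
  have h := hP.contract (Finset.sdiff_subset (s := P) (t := A)) hne (by
    rw [IsTight, hP.verts_sdiff hA, cut_compl]
    exact ht)
  rwa [hP.verts_sdiff hA, Finset.sdiff_sdiff_eq_self hA] at h

/-- Such a node would meet every member of `A`, hence equal each of them, but `A` has two. So a
contraction really adds a new node. -/
theorem verts_notMem (hP : IsContraction G P) {A : Finset (Finset V)} (hA : A ⊆ P)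
    (h2 : 2 ≤ A.card) : verts A ∉ P := by
  intro h
  obtain ⟨X, hX, Y, hY, hXY⟩ := Finset.one_lt_card.1 h2
  have key : ∀ Z ∈ A, Z = verts A := by
    intro Z hZ
    obtain ⟨v, hv⟩ := hP.nonempty Z (hA hZ)
    exact ((mem_iff_eq_of_pairwiseDisjoint hP.disjoint (hA hZ) h hv).1 (subset_verts hZ hv)).symm
  exact hXY ((key X hX).trans (key Y hY).symm)

end IsContraction

/-! ### Nodes and sampled edges along an execution. -/

namespace Execution

variable {G : Finset (Edge V)} {f : Sym2 V} (R : Execution G f)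

theorem sel_subset {i : ℕ} (hi : i ≤ R.k) : R.sel i ⊆ R.nodes i := by
  rcases hi.lt_or_eq with h | rfl
  · exact (R.sel_candidate i h).1.1.1
  · exact R.sel_last.subset

theorem isContraction_nodes (hG : ∀ u : V, (cut G {u}).card = 4) {i : ℕ} (hi : i ≤ R.k) :
    IsContraction G (R.nodes i) := by
  induction i with
  | zero =>
    rw [R.nodes_zero]
    refine ⟨?_, ?_, fun v => ⟨{v}, by simp, by simp⟩, ?_⟩
    · intro X hX Y hY hXY
      simp only [Finset.coe_image, Finset.coe_univ, Set.image_univ, Set.mem_range] at hX hY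
      obtain ⟨u, rfl⟩ := hX
      obtain ⟨v, rfl⟩ := hY
      exact Finset.disjoint_singleton.2 fun h => hXY (by rw [h])
    · intro X hX
      obtain ⟨u, -, rfl⟩ := Finset.mem_image.1 hX
      exact Finset.singleton_nonempty u
    · intro X hX
      obtain ⟨u, -, rfl⟩ := Finset.mem_image.1 hX
      exact hG u
  | succ i ih =>
    obtain ⟨⟨⟨h1, h2, -⟩, h3, -⟩, -⟩ := R.sel_candidate i hi
    rw [R.nodes_succ i hi]
    exact (ih (Nat.le_of_succ_le hi)).contract h1 (Finset.card_pos.1 (by omega)) h3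

/-- A proper set leaves at least two nodes outside, and the merged node is a third. -/
theorem three_le_card_nodes (hG : ∀ u : V, (cut G {u}).card = 4) (hV : 3 ≤ Fintype.card V)
    {i : ℕ} (hi : i ≤ R.k) : 3 ≤ (R.nodes i).card := by
  cases i with
  | zero =>
    rw [R.nodes_zero, Finset.card_image_of_injective _ Finset.singleton_injective]
    exact hV
  | succ i =>
    obtain ⟨⟨⟨h1, h2, h3⟩, -⟩, -⟩ := R.sel_candidate i hi
    have hP := R.isContraction_nodes hG (Nat.le_of_succ_le hi)
    rw [R.nodes_succ i hi, Finset.card_insert_of_notMem]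
    · omega
    · exact fun h => hP.verts_notMem h1 h2 (Finset.mem_sdiff.1 h).1

/-- Candidates never contain both ends of `f`, so `f` survives every contraction and is available to
the final tour. -/
theorem not_forall_mem_node (hf : ¬ f.IsDiag) {i : ℕ} (hi : i ≤ R.k) :
    ∀ X ∈ R.nodes i, ¬ ∀ v ∈ f, v ∈ X := by
  induction i with
  | zero =>
    rw [R.nodes_zero]
    intro X hX h
    obtain ⟨u, -, rfl⟩ := Finset.mem_image.1 hX
    induction f using Sym2.ind with
    | _ a b =>
      have h1 := h a (Sym2.mem_mk_left a b)
      have h2 := h b (Sym2.mem_mk_right a b)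
      rw [Finset.mem_singleton] at h1 h2
      exact hf (by rw [h1, h2]; simp)
  | succ i ih =>
    rw [R.nodes_succ i hi]
    intro X hX
    rcases Finset.mem_insert.1 hX with rfl | hX
    · exact (R.sel_candidate i hi).2
    · exact ih (Nat.le_of_succ_le hi) X (Finset.mem_sdiff.1 hX).1

theorem exists_node_superset {i j : ℕ} (hij : i ≤ j) (hj : j ≤ R.k) {X : Finset V}
    (hX : X ∈ R.nodes i) : ∃ Y ∈ R.nodes j, X ⊆ Y := by
  induction j, hij using Nat.le_induction with
  | base => exact ⟨X, hX, le_rfl⟩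
  | succ j _ ih =>
    obtain ⟨Y, hY, hXY⟩ := ih (Nat.le_of_succ_le hj)
    rw [R.nodes_succ j hj]
    by_cases hYs : Y ∈ R.sel j
    · exact ⟨_, Finset.mem_insert_self _ _, hXY.trans (subset_verts hYs)⟩
    · exact ⟨Y, Finset.mem_insert_of_mem (Finset.mem_sdiff.2 ⟨hY, hYs⟩), hXY⟩

/-- Once a set has been contracted it lies within one node at all later times, so its inner edges
never again join distinct nodes. -/
theorem disjoint_innerEdges_of_lt (hG : ∀ u : V, (cut G {u}).card = 4) {i j : ℕ} (hij : i < j)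
    (hj : j ≤ R.k) : Disjoint (innerEdges G (R.sel i)) (innerEdges G (R.sel j)) := by
  rw [Finset.disjoint_left]
  intro e hei hej
  obtain ⟨-, X, hX, Y, hY, -, hJ⟩ := mem_innerEdges.1 hei
  obtain ⟨-, X', hX', Y', hY', hne, hJ'⟩ := mem_innerEdges.1 hej
  have hmem : verts (R.sel i) ∈ R.nodes (i + 1) := by
    rw [R.nodes_succ i (by omega)]
    exact Finset.mem_insert_self _ _
  obtain ⟨Z, hZ, hsub⟩ := R.exists_node_superset hij hj hmem
  have hP := R.isContraction_nodes hG hj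
  have hXn := R.sel_subset hj hX'
  have hYn := R.sel_subset hj hY'
  refine hJ'.not_self
    (hJ.mono ((subset_verts hX).trans hsub) ((subset_verts hY).trans hsub)) ?_
  by_cases h : X' = Z
  · exact Or.inr (hP.disjoint_of_ne hYn hZ (h ▸ hne.symm))
  · exact Or.inl (hP.disjoint_of_ne hXn hZ h)

theorem disjoint_innerEdges (hG : ∀ u : V, (cut G {u}).card = 4) {i j : ℕ} (hij : i ≠ j)
    (hi : i ≤ R.k) (hj : j ≤ R.k) :
    Disjoint (innerEdges G (R.sel i)) (innerEdges G (R.sel j)) := by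
  rcases lt_or_gt_of_ne hij with h | h
  · exact R.disjoint_innerEdges_of_lt hG h hj
  · exact (R.disjoint_innerEdges_of_lt hG h hi).symm

/-- An edge disappears only in a round whose selected set contains both its end nodes, and then it
is inner there. An edge that never disappears is inner at the root. -/
theorem exists_mem_innerEdges (hG : ∀ u : V, (cut G {u}).card = 4)
    (hloop : ∀ e ∈ G, ¬ e.1.IsDiag) {e : Edge V} (he : e ∈ G) :
    ∃ i ≤ R.k, e ∈ innerEdges G (R.sel i) := by
  have key : ∀ j ≤ R.k, (∃ i < j, e ∈ innerEdges G (R.sel i)) ∨ e ∈ innerEdges G (R.nodes j) := by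
    intro j hj
    induction j with
    | zero =>
      right
      obtain ⟨X, hX, Y, hY, hJ⟩ := joins_exists (R.isContraction_nodes hG hj).cover e
      refine mem_innerEdges.2 ⟨he, X, hX, Y, hY, ?_, hJ⟩
      rintro rfl
      rw [R.nodes_zero] at hX
      obtain ⟨w, -, rfl⟩ := Finset.mem_image.1 hX
      obtain ⟨u, hu, v, hv, huv⟩ := hJ
      rw [Finset.mem_singleton] at hu hv
      exact hloop e he (by rw [huv, hu, hv]; simp)
    | succ j ih =>
      rcases ih (Nat.le_of_succ_le hj) with ⟨i, hi, hei⟩ | hej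
      · exact Or.inl ⟨i, Nat.lt_succ_of_lt hi, hei⟩
      · obtain ⟨-, X, hX, Y, hY, hne, hJ⟩ := mem_innerEdges.1 hej
        have hP := R.isContraction_nodes hG (Nat.le_of_succ_le hj)
        have hs := R.sel_subset (Nat.le_of_succ_le hj)
        by_cases hXs : X ∈ R.sel j <;> by_cases hYs : Y ∈ R.sel j
        · exact Or.inl ⟨j, Nat.lt_succ_self j, mem_innerEdges.2 ⟨he, X, hXs, Y, hYs, hne, hJ⟩⟩
        all_goals right; rw [R.nodes_succ j hj]
        · refine mem_innerEdges.2 ⟨he, _, Finset.mem_insert_self _ _, Y,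
            Finset.mem_insert_of_mem (Finset.mem_sdiff.2 ⟨hY, hYs⟩), ?_,
            hJ.mono (subset_verts hXs) le_rfl⟩
          rintro rfl
          exact (hP.nonempty _ hY).ne_empty
            (Finset.disjoint_self_iff_empty _ |>.1 (hP.disjoint_verts hs hY hYs))
        · refine mem_innerEdges.2 ⟨he, X,
            Finset.mem_insert_of_mem (Finset.mem_sdiff.2 ⟨hX, hXs⟩), _,
            Finset.mem_insert_self _ _, ?_, hJ.mono le_rfl (subset_verts hYs)⟩
          rintro rfl
          exact (hP.nonempty _ hX).ne_empty
            (Finset.disjoint_self_iff_empty _ |>.1 (hP.disjoint_verts hs hX hXs))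
        · exact mem_innerEdges.2 ⟨he, X, Finset.mem_insert_of_mem (Finset.mem_sdiff.2 ⟨hX, hXs⟩),
            Y, Finset.mem_insert_of_mem (Finset.mem_sdiff.2 ⟨hY, hYs⟩), hne, hJ⟩
  rcases key R.k le_rfl with ⟨i, hi, hei⟩ | hek
  · exact ⟨i, hi.le, hei⟩
  · exact ⟨R.k, le_rfl, by rwa [R.sel_last]⟩

end Execution

/-! ### Doubled edges inside a minimal candidate. -/

namespace IsContraction

variable {G : Finset (Edge V)} {P : Finset (Finset V)}

/-- Inside a minimal candidate which has two nodes or contains a proper tight set, and whose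
complement is contracted, all edges are doubled. -/
theorem card_joinEdges_of_minimal (hP : IsContraction G P) {f : Sym2 V}
    (hG : ∀ S : Finset V, S.Nonempty → S ≠ Finset.univ → 4 ≤ (cut G S).card)
    {S : Finset (Finset V)} (hS : IsCandidate G f P S)
    (hmin : ∀ B ⊂ S, ¬ IsCandidate G f P B)
    (hcyc : S.card = 2 ∨ ∃ B ⊂ S, 2 ≤ B.card ∧ IsTight G B)
    {X Y : Finset V} (hX : X ∈ insert (verts S)ᶜ S) (hY : Y ∈ insert (verts S)ᶜ S) (hXY : X ≠ Y) :
    (joinEdges G X Y).card = 0 ∨ (joinEdges G X Y).card = 2 := by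
  obtain ⟨⟨⟨hSP, hS2, hSc2⟩, hSt, hSu⟩, hSf⟩ := hS
  have hcne : (P \ S).Nonempty := Finset.card_pos.1 (by omega)
  have hQ := hP.contract_compl hSP hcne hSt
  have hO : (verts S)ᶜ ∉ S := by
    intro h
    obtain ⟨v, hv⟩ := hP.nonempty _ (hSP h)
    exact Finset.mem_compl.1 hv (subset_verts h hv)
  -- a proper tight subset of `S` is crossed by a tight subset of `S`
  have key : ∀ B ⊂ S, 2 ≤ B.card → IsTight G B →
      ∃ C ⊆ S, IsTight G C ∧ (B \ C).Nonempty ∧ (C \ B).Nonempty ∧ (B ∩ C).Nonempty := by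
    intro B hB hB2 hBt
    have hBP := hB.1.trans hSP
    have hnot := hmin B hB
    have hBf : ¬ ∀ v ∈ f, v ∈ verts B := fun h => hSf fun v hv => verts_mono hB.1 (h v hv)
    have hBp : IsProper P B := ⟨hBP, hB2, hSc2.trans
      (Finset.card_le_card (Finset.sdiff_subset_sdiff le_rfl hB.1))⟩
    have hex : ∃ C ⊆ P, IsTight G C ∧ Crosses P B C := by
      by_contra hcon
      push Not at hcon
      exact hnot ⟨⟨hBp, hBt, hcon⟩, hBf⟩
    obtain ⟨C, hCP, hCt, c1, c2, c3, c4⟩ := hex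
    by_cases hCS : C ⊆ S
    · exact ⟨C, hCS, hCt, c1, c2, c3⟩
    · have hncross := hSu C hCP hCt
      have hU : ¬ (P \ (S ∪ C)).Nonempty := by
        intro hne
        refine hncross ⟨?_, ?_, ?_, hne⟩
        · exact c1.mono (Finset.sdiff_subset_sdiff hB.1 le_rfl)
        · rwa [Finset.sdiff_nonempty]
        · exact c3.mono (Finset.inter_subset_inter hB.1 le_rfl)
      rw [Finset.not_nonempty_iff_eq_empty, Finset.sdiff_eq_empty_iff_subset] at hU
      refine ⟨P \ C, ?_, ?_, ?_, ?_, ?_⟩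
      · intro Z hZ
        rw [Finset.mem_sdiff] at hZ
        exact (Finset.mem_union.1 (hU hZ.1)).resolve_right hZ.2
      · rw [IsTight, hP.verts_sdiff hCP, cut_compl]
        exact hCt
      · obtain ⟨Z, hZ⟩ := c3
        rw [Finset.mem_inter] at hZ
        exact ⟨Z, by simp [hZ.1, hZ.2]⟩
      · obtain ⟨Z, hZ⟩ := c4
        rw [Finset.mem_sdiff, Finset.mem_union, not_or] at hZ
        exact ⟨Z, by simp [hZ.1, hZ.2.1, hZ.2.2]⟩
      · obtain ⟨Z, hZ⟩ := c1
        rw [Finset.mem_sdiff] at hZ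
        exact ⟨Z, by simp [hZ.1, hZ.2, hBP hZ.1]⟩
  -- the same in the graph in which the complement of `S` has been contracted
  have key' : ∀ B ⊆ S, IsProper (insert (verts S)ᶜ S) B → IsTight G B →
      ∃ C ⊆ S, IsTight G C ∧ (B \ C).Nonempty ∧ (C \ B).Nonempty ∧ (B ∩ C).Nonempty := by
    rintro B hBS ⟨-, hB2, hBc⟩ hBt
    refine key B (Finset.ssubset_iff_subset_ne.2 ⟨hBS, ?_⟩) hB2 hBt
    -- The whole of `S` is not proper here: its complement is the single contracted node.
    rintro rfl
    have : insert (verts B)ᶜ B \ B ⊆ {(verts B)ᶜ} := by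
      intro Z hZ
      simp only [Finset.mem_sdiff, Finset.mem_insert, Finset.mem_singleton] at hZ ⊢
      tauto
    have := Finset.card_le_card this
    rw [Finset.card_singleton] at this
    omega
  refine hQ.card_joinEdges_eq hG ?_ ?_ hX hY hXY
  · rintro A ⟨hAp, hAt, hAu⟩
    -- Crossing is invariant under complementing `A`, so the set can be taken to avoid the
    -- contracted node, which then lies outside both sets.
    by_cases hOA : (verts S)ᶜ ∈ A
    · have hB : insert (verts S)ᶜ S \ A ⊆ S := by
        intro Z hZ
        rw [Finset.mem_sdiff, Finset.mem_insert] at hZ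
        exact hZ.1.resolve_left fun h => hZ.2 (h ▸ hOA)
      obtain ⟨C, hCS, hCt, ⟨Z1, h1⟩, ⟨Z2, h2⟩, ⟨Z3, h3⟩⟩ := key' _ hB
        ⟨Finset.sdiff_subset, hAp.2.2, by rw [Finset.sdiff_sdiff_eq_self hAp.1]; exact hAp.2.1⟩
        (by rw [IsTight, hQ.verts_sdiff hAp.1, cut_compl]; exact hAt)
      simp only [Finset.mem_sdiff, Finset.mem_inter] at h1 h2 h3
      have hZ2 : Z2 ∈ A := by
        by_contra h
        exact h2.2 ⟨Finset.mem_insert_of_mem (hCS h2.1), h⟩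
      refine hAu C (hCS.trans (Finset.subset_insert _ _)) hCt ⟨⟨(verts S)ᶜ, ?_⟩, ⟨Z3, ?_⟩, ⟨Z2, ?_⟩, ⟨Z1, ?_⟩⟩
      · exact Finset.mem_sdiff.2 ⟨hOA, fun h => hO (hCS h)⟩
      · simp [h3.1.2, h3.2]
      · simp [hZ2, h2.1]
      · rw [Finset.mem_sdiff, Finset.mem_union, not_or]
        exact ⟨h1.1.1, h1.1.2, h1.2⟩
    · have hB : A ⊆ S := fun Z hZ =>
        (Finset.mem_insert.1 (hAp.1 hZ)).resolve_left fun h => hOA (h ▸ hZ)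
      obtain ⟨C, hCS, hCt, h1, h2, h3⟩ := key' A hB hAp hAt
      refine hAu C (hCS.trans (Finset.subset_insert _ _)) hCt ⟨h1, h2, h3, ⟨(verts S)ᶜ, ?_⟩⟩
      rw [Finset.mem_sdiff, Finset.mem_union, not_or]
      exact ⟨Finset.mem_insert_self _ _, hOA, fun h => hO (hCS h)⟩
  · rcases hcyc with h | ⟨B, hB, hB2, hBt⟩
    · left
      rw [Finset.card_insert_of_notMem hO, h]
    · right
      refine ⟨B, ⟨hB.1.trans (Finset.subset_insert _ _), hB2, ?_⟩, hBt⟩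
      obtain ⟨Z, hZS, hZB⟩ := Finset.exists_of_ssubset hB
      have hsub : ({Z, (verts S)ᶜ} : Finset (Finset V)) ⊆ insert (verts S)ᶜ S \ B := by
        intro W hW
        rw [Finset.mem_insert, Finset.mem_singleton] at hW
        rcases hW with rfl | rfl
        · simp [hZS, hZB]
        · exact Finset.mem_sdiff.2 ⟨Finset.mem_insert_self _ _, fun h => hO (hB.1 h)⟩
      have hZO : Z ≠ (verts S)ᶜ := fun h => hO (h ▸ hZS)
      rw [← Finset.card_pair hZO]
      exact Finset.card_le_card hsub

end IsContraction

/-! ### Tours of a doubled cycle. -/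

namespace IsContraction

variable {G : Finset (Edge V)} {P : Finset (Finset V)}

theorem eq_of_joins (hP : IsContraction G P) {e : Edge V} {X Y X' Y' : Finset V} (hX : X ∈ P)
    (hY : Y ∈ P) (hX' : X' ∈ P) (hY' : Y' ∈ P) (h : Joins e X Y) (h' : Joins e X' Y') :
    (X' = X ∧ Y' = Y) ∨ (X' = Y ∧ Y' = X) := by
  obtain ⟨u, hu, v, hv, he⟩ := h
  obtain ⟨u', hu', v', hv', he'⟩ := h'
  rw [he] at he'
  rcases Sym2.eq_iff.1 he' with ⟨rfl, rfl⟩ | ⟨rfl, rfl⟩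
  · exact Or.inl ⟨(mem_iff_eq_of_pairwiseDisjoint hP.disjoint hX hX' hu).1 hu',
      (mem_iff_eq_of_pairwiseDisjoint hP.disjoint hY hY' hv).1 hv'⟩
  · exact Or.inr ⟨(mem_iff_eq_of_pairwiseDisjoint hP.disjoint hY hX' hv).1 hu',
      (mem_iff_eq_of_pairwiseDisjoint hP.disjoint hX hY' hu).1 hv'⟩

theorem cut_eq_biUnion (hP : IsContraction G P) {X : Finset V} (hX : X ∈ P) :
    cut G X = (P.erase X).biUnion (joinEdges G X) := by
  ext e
  simp only [mem_cut, Finset.mem_biUnion, Finset.mem_erase, mem_joinEdges]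
  constructor
  · rintro ⟨he, u, hu, v, hv, huv⟩
    obtain ⟨Y, hY, hvY⟩ := hP.cover v
    refine ⟨Y, ⟨?_, hY⟩, he, u, hu, v, hvY, huv⟩
    rintro rfl
    exact Finset.mem_compl.1 hv hvY
  · rintro ⟨Y, ⟨hYX, hY⟩, he, hJ⟩
    refine ⟨he, hJ.mono le_rfl fun v hv => Finset.mem_compl.2 fun hvX => ?_⟩
    exact Finset.disjoint_left.1 (hP.disjoint_of_ne hY hX hYX) hv hvX

theorem card_inter_cut (hP : IsContraction G P) {X : Finset V} (hX : X ∈ P)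
    (T : Finset (Edge V)) :
    (T ∩ cut G X).card = ∑ Y ∈ P.erase X, (T ∩ joinEdges G X Y).card := by
  rw [hP.cut_eq_biUnion hX, Finset.inter_biUnion, Finset.card_biUnion]
  intro Y hY Z hZ hYZ
  rw [Finset.mem_coe, Finset.mem_erase] at hY hZ
  refine Finset.disjoint_left.2 fun e h1 h2 => ?_
  have h1 := (mem_joinEdges.1 (Finset.mem_inter.1 h1).2).2
  have h2 := (mem_joinEdges.1 (Finset.mem_inter.1 h2).2).2
  rcases hP.eq_of_joins hX hY.2 hX hZ.2 h1 h2 with ⟨-, h⟩ | ⟨h, -⟩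
  · exact hYZ h.symm
  · exact hY.1 h.symm

theorem sum_card_joinEdges (hP : IsContraction G P) {X : Finset V} (hX : X ∈ P) :
    ∑ Y ∈ P.erase X, (joinEdges G X Y).card = 4 := by
  rw [← hP.card_cut X hX, ← Finset.inter_self (cut G X), hP.card_inter_cut hX]
  refine Finset.sum_congr rfl fun Y hY => ?_
  congr 1
  refine (Finset.inter_eq_right.2 ?_).symm
  rw [hP.cut_eq_biUnion hX]
  exact Finset.subset_biUnion_of_mem _ hY

theorem joinEdges_subset_innerEdges {A : Finset (Finset V)} {X Y : Finset V} (hX : X ∈ A)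
    (hY : Y ∈ A) (h : X ≠ Y) : joinEdges G X Y ⊆ innerEdges G A := by
  intro e he
  rw [mem_joinEdges] at he
  exact mem_innerEdges.2 ⟨he.1, X, hX, Y, hY, h, he.2⟩

theorem cut_subset_innerEdges (hP : IsContraction G P) {X : Finset V} (hX : X ∈ P) :
    cut G X ⊆ innerEdges G P := by
  rw [hP.cut_eq_biUnion hX, Finset.biUnion_subset]
  intro Y hY
  rw [Finset.mem_erase] at hY
  exact joinEdges_subset_innerEdges hX hY.2 hY.1.symm

/-- In a cycle with doubled edges, the tours contain exactly one of any two parallel edges. -/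
theorem isTour_iff (hP : IsContraction G P)
    (hG : ∀ S : Finset V, S.Nonempty → S ≠ Finset.univ → 4 ≤ (cut G S).card)
    (hd : ∀ X ∈ P, ∀ Y ∈ P, X ≠ Y → (joinEdges G X Y).card = 0 ∨ (joinEdges G X Y).card = 2)
    (h3 : 3 ≤ P.card) {f : Sym2 V} (hf : ∀ i : Fin 2, ((f, i) : Edge V) ∈ G)
    (hfP : ∀ X ∈ P, ¬ ∀ v ∈ f, v ∈ X) (T : Finset (Edge V)) :
    IsTour G f P T ↔ T ⊆ innerEdges G P ∧
      ∀ X ∈ P, ∀ Y ∈ P, X ≠ Y → 2 * (T ∩ joinEdges G X Y).card = (joinEdges G X Y).card := by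
  have hle : ∀ X Y, (T ∩ joinEdges G X Y).card ≤ (joinEdges G X Y).card := fun X Y =>
    Finset.card_le_card Finset.inter_subset_right
  constructor
  · rintro ⟨hT, hc, hdeg, -⟩
    refine ⟨hT, ?_⟩
    -- Two tour edges between `X` and `Y` exhaust the degree of both nodes, which cuts them off from
    -- a third node.
    have hno : ∀ X ∈ P, ∀ Y ∈ P, X ≠ Y → (T ∩ joinEdges G X Y).card ≤ 1 := by
      intro X hX Y hY hXY
      by_contra hlt
      have hz : ∀ X ∈ P, ∀ Y ∈ P, X ≠ Y → 2 ≤ (T ∩ joinEdges G X Y).card →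
          ∀ Z ∈ P, Z ≠ X → Z ≠ Y → T ∩ joinEdges G X Z = ∅ := by
        intro X hX Y hY hXY h2 Z hZ hZX hZY
        have h := hdeg X hX
        rw [hP.card_inter_cut hX] at h
        have hsub : ({Y, Z} : Finset (Finset V)) ⊆ P.erase X := by
          intro W hW
          rw [Finset.mem_insert, Finset.mem_singleton] at hW
          rcases hW with rfl | rfl
          · exact Finset.mem_erase.2 ⟨hXY.symm, hY⟩
          · exact Finset.mem_erase.2 ⟨hZX, hZ⟩
        have := Finset.sum_le_sum_of_subset (f := fun Y => (T ∩ joinEdges G X Y).card) hsub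
        rw [Finset.sum_pair hZY.symm, h] at this
        rw [← Finset.card_eq_zero]
        omega
      have hsub : ¬ P ⊆ {X, Y} := by
        intro h
        have := (Finset.card_le_card h).trans Finset.card_le_two
        omega
      obtain ⟨Z, hZ, hZXY⟩ := Finset.not_subset.1 hsub
      rw [Finset.mem_insert, Finset.mem_singleton, not_or] at hZXY
      have hpath := hc X hX Z hZ
      have hinv : ∀ W, Relation.ReflTransGen
          (fun X' Y' => X' ∈ P ∧ Y' ∈ P ∧ ∃ e ∈ T, Joins e X' Y') X W → W = X ∨ W = Y := by
        intro W hW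
        induction hW with
        | refl => exact Or.inl rfl
        | @tail W W' _ h ih =>
          obtain ⟨hW, hW', e, he, hJ⟩ := h
          have heG := (mem_innerEdges.1 (hT he)).1
          have hmem : e ∈ T ∩ joinEdges G W W' := Finset.mem_inter.2 ⟨he, mem_joinEdges.2 ⟨heG, hJ⟩⟩
          by_contra hcon
          rw [not_or] at hcon
          rcases ih with rfl | rfl
          · rw [hz W hX Y hY hXY (by omega) W' hW' hcon.1 hcon.2] at hmem
            simp at hmem
          · rw [hz W hY X hX hXY.symm (by rw [joinEdges_comm]; omega) W' hW' hcon.2 hcon.1] at hmem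
            simp at hmem
      rcases hinv Z hpath with h | h
      · exact hZXY.1 h
      · exact hZXY.2 h
    intro X hX Y hY hXY
    have h1 : ∀ Y ∈ P.erase X, 2 * (T ∩ joinEdges G X Y).card ≤ (joinEdges G X Y).card := by
      intro Y hY
      rw [Finset.mem_erase] at hY
      have a1 := hno X hX Y hY.2 hY.1.symm
      have a2 := hle X Y
      rcases hd X hX Y hY.2 hY.1.symm with h | h <;> omega
    have h2 : ∑ Y ∈ P.erase X, 2 * (T ∩ joinEdges G X Y).card =
        ∑ Y ∈ P.erase X, (joinEdges G X Y).card := by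
      rw [← Finset.mul_sum, ← hP.card_inter_cut hX, hdeg X hX, hP.sum_card_joinEdges hX]
      norm_num
    -- Each class contributes at most half of its edges, and the degree 2 out of 4 is exactly half,
    -- so equality holds in every class.
    exact (Finset.sum_eq_sum_iff_of_le h1).1 h2 Y (Finset.mem_erase.2 ⟨hXY.symm, hY⟩)
  · rintro ⟨hT, hb⟩
    refine ⟨hT, ?_, ?_, ?_⟩
    · intro X hX Y hY
      by_contra hXY
      classical
      set r : Finset V → Finset V → Prop :=
        fun X' Y' => X' ∈ P ∧ Y' ∈ P ∧ ∃ e ∈ T, Joins e X' Y' with hr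
      set C := P.filter (Relation.ReflTransGen r X) with hC
      have hCP : C ⊆ P := Finset.filter_subset _ _
      have hXC : X ∈ C := Finset.mem_filter.2 ⟨hX, Relation.ReflTransGen.refl⟩
      have hYC : Y ∉ C := fun h => hXY (Finset.mem_filter.1 h).2
      -- The cut around the component `C` contains an edge of `G`. Its parallel class is nonempty,
      -- so half of it lies in `T`, and one of these edges leaves `C`.
      have h4 := hG (verts C) (hP.verts_nonempty hCP ⟨X, hXC⟩)
        (hP.verts_ne_univ hCP ⟨Y, Finset.mem_sdiff.2 ⟨hY, hYC⟩⟩)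
      obtain ⟨e, he⟩ := Finset.card_pos.1 (by omega : 0 < (cut G (verts C)).card)
      obtain ⟨heG, u, hu, v, hv, huv⟩ := mem_cut.1 he
      obtain ⟨Z, hZ, huZ⟩ := mem_verts.1 hu
      obtain ⟨W, hW, hvW⟩ := hP.cover v
      have hWC : W ∉ C := fun h => Finset.mem_compl.1 hv (subset_verts h hvW)
      have hZW : Z ≠ W := fun h => hWC (h ▸ hZ)
      have heJ : e ∈ joinEdges G Z W := mem_joinEdges.2 ⟨heG, u, huZ, v, hvW, huv⟩
      have hpos := Finset.card_pos.2 ⟨e, heJ⟩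
      have := hb Z (hCP hZ) W hW hZW
      obtain ⟨e', he'⟩ := Finset.card_pos.1 (by omega : 0 < (T ∩ joinEdges G Z W).card)
      rw [Finset.mem_inter] at he'
      exact hWC (Finset.mem_filter.2 ⟨hW, (Finset.mem_filter.1 hZ).2.tail
        ⟨hCP hZ, hW, e', he'.1, (mem_joinEdges.1 he'.2).2⟩⟩)
    · intro X hX
      have h2 : ∑ Y ∈ P.erase X, 2 * (T ∩ joinEdges G X Y).card =
          ∑ Y ∈ P.erase X, (joinEdges G X Y).card := by
        refine Finset.sum_congr rfl fun Y hY => ?_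
        rw [Finset.mem_erase] at hY
        exact hb X hX Y hY.2 hY.1.symm
      rw [← Finset.mul_sum, ← hP.card_inter_cut hX, hP.sum_card_joinEdges hX] at h2
      omega
    · obtain ⟨X, hX, Y, hY, hJ⟩ := joins_exists hP.cover ((f, 0) : Edge V)
      have hXY : X ≠ Y := by
        rintro rfl
        obtain ⟨u, hu, v, hv, huv⟩ := hJ
        refine hfP X hX fun w hw => ?_
        change f = s(u, v) at huv
        rw [huv, Sym2.mem_iff] at hw
        rcases hw with rfl | rfl <;> assumption
      have hmem : ∀ i : Fin 2, ((f, i) : Edge V) ∈ joinEdges G X Y := fun i =>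
        mem_joinEdges.2 ⟨hf i, hJ⟩
      have hsub : ({(f, 0), (f, 1)} : Finset (Edge V)) ⊆ joinEdges G X Y := by
        intro e he
        rw [Finset.mem_insert, Finset.mem_singleton] at he
        rcases he with rfl | rfl <;> exact hmem _
      have hne : ((f, 0) : Edge V) ≠ (f, 1) := by simp
      have hc2 : (joinEdges G X Y).card = 2 := by
        have := Finset.card_pos.2 ⟨_, hmem 0⟩
        rcases hd X hX Y hY hXY with h | h <;> omega
      -- The two copies of `f` are the whole parallel class, so the edge chosen from this class is a
      -- copy of `f`.
      have heq := Finset.eq_of_subset_of_card_le hsub (by rw [hc2, Finset.card_pair hne])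
      have := hb X hX Y hY hXY
      obtain ⟨e, he⟩ := Finset.card_pos.1 (by omega : 0 < (T ∩ joinEdges G X Y).card)
      rw [Finset.mem_inter, ← heq, Finset.mem_insert, Finset.mem_singleton] at he
      refine ⟨e, he.1, ?_⟩
      rcases he.2 with h | h <;> rw [h]

end IsContraction

/-- A uniformly random set that contains exactly one element of each class of a partition of `E`
into pairs is determinantal. -/
theorem isHalfDeterminantal_transversal {α β : Type*} [Fintype α] [DecidableEq α] [DecidableEq β]
    (E : Finset α) (c : α → β) (hc : ∀ q ∈ E.image c, (E.filter fun e => c e = q).card = 2)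
    (Q : Finset α → Prop) [DecidablePred Q]
    (hQ : ∀ T, Q T ↔ T ⊆ E ∧ ∀ q ∈ E.image c, (T.filter fun e => c e = q).card = 1) :
    IsHalfDeterminantal
      (fun T => if Q T then 1 / ((Finset.univ.filter Q).card : ℝ) else 0) E := by
  set B : Matrix (E.image c) α ℝ := Matrix.of fun q e => if e ∈ E ∧ c e = q then 1 else 0 with hB
  have hcard : ∀ T, Q T → T.card = Fintype.card (E.image c) := by
    intro T hT
    rw [hQ] at hT
    rw [Finset.card_eq_sum_card_fiberwise (f := c) (t := E.image c), Finset.sum_congr rfl hT.2]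
    · simp
    · exact fun e he => Finset.mem_image_of_mem c (hT.1 he)
  have hdet : ∀ φ : E.image c → α, Function.Injective φ →
      (B.submatrix id φ).det ^ 2 = if Q (Finset.univ.image φ) then 1 else 0 := by
    intro φ hφ
    by_cases hE : ∀ i, φ i ∈ E
    swap
    · push Not at hE
      obtain ⟨i, hi⟩ := hE
      rw [Matrix.det_eq_zero_of_column_eq_zero i fun q => by simp [hB, hi], if_neg]
      · norm_num
      · intro h
        exact hi (((hQ _).1 h).1 (Finset.mem_image_of_mem _ (Finset.mem_univ i)))
    set σ : E.image c → E.image c := fun i => ⟨c (φ i), Finset.mem_image_of_mem c (hE i)⟩ with hσ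
    have hBσ : ∀ q i, B.submatrix id φ q i = if σ i = q then 1 else 0 := by
      intro q i
      simp [hB, hE i, hσ, Subtype.ext_iff]
    -- The columns of the minor are unit vectors. It is a permutation matrix if `φ` meets each class
    -- once; otherwise two columns coincide.
    by_cases hinj : Function.Injective σ
    · have hbij := Finite.injective_iff_bijective.1 hinj
      rw [if_pos]
      · have hMM : B.submatrix id φ * (B.submatrix id φ)ᵀ = 1 := by
          ext q q'
          rw [Matrix.mul_apply, Matrix.one_apply]
          simp only [Matrix.transpose_apply, hBσ]
          obtain ⟨i, rfl⟩ := hbij.2 q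
          rw [Finset.sum_eq_single i]
          · simp
          · intro j _ hj
            simp [hinj.ne hj]
          · simp
        have := congrArg Matrix.det hMM
        rw [Matrix.det_mul, Matrix.det_transpose, Matrix.det_one] at this
        rw [sq, this]
      · rw [hQ]
        refine ⟨fun e he => ?_, fun q hq => ?_⟩
        · obtain ⟨i, -, rfl⟩ := Finset.mem_image.1 he
          exact hE i
        · obtain ⟨i, hi⟩ := hbij.2 ⟨q, hq⟩
          rw [Finset.card_eq_one]
          refine ⟨φ i, ?_⟩
          ext e
          simp only [Finset.mem_filter, Finset.mem_image, Finset.mem_univ, true_and,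
            Finset.mem_singleton]
          constructor
          · rintro ⟨⟨j, rfl⟩, hj⟩
            have : σ j = σ i := by rw [hi]; exact Subtype.ext hj
            rw [hinj this]
          · rintro rfl
            exact ⟨⟨i, rfl⟩, congrArg Subtype.val hi⟩
    · have hnot : ¬ Q (Finset.univ.image φ) := by
        intro h
        refine hinj fun i j hij => ?_
        have h1 := ((hQ _).1 h).2 _ (σ i).2
        obtain ⟨e, he⟩ := Finset.card_eq_one.1 h1
        have hmem : ∀ l, σ l = σ i → φ l = e := by
          intro l hl
          rw [← Finset.mem_singleton, ← he, Finset.mem_filter]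
          exact ⟨Finset.mem_image_of_mem _ (Finset.mem_univ l), congrArg Subtype.val hl⟩
        exact hφ ((hmem i rfl).trans (hmem j hij.symm).symm)
      have hij : ∃ i j, i ≠ j ∧ σ i = σ j := by
        simp only [Function.Injective] at hinj
        push Not at hinj
        obtain ⟨i, j, h1, h2⟩ := hinj
        exact ⟨i, j, h2, h1⟩
      obtain ⟨i, j, hne, hs⟩ := hij
      rw [if_neg hnot, Matrix.det_zero_of_column_eq hne fun q => by rw [hBσ, hBσ, hs]]
      norm_num
  have hgram := det_gram_eq_sum B Q hcard hdet
  have hdiag : ∀ s : α → ℝ, (B * diagonal s * Bᵀ).det =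
      ∏ q : E.image c, ∑ e ∈ E.filter (fun e => c e = q), s e := by
    intro s
    rw [← Matrix.det_diagonal]
    congr 1
    ext q q'
    rw [Matrix.mul_apply, Matrix.diagonal_apply]
    simp only [Matrix.mul_diagonal, Matrix.transpose_apply, hB, Matrix.of_apply]
    split_ifs with hqq
    · subst hqq
      have hf : E.filter (fun e => c e = q) = Finset.univ.filter fun e => e ∈ E ∧ c e = q := by
        ext e
        simp
      rw [hf, Finset.sum_filter]
      refine Finset.sum_congr rfl fun e _ => ?_
      split_ifs <;> simp
    · refine Finset.sum_eq_zero fun e _ => ?_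
      by_cases h : e ∈ E ∧ c e = q
      · rw [if_neg fun h' : e ∈ E ∧ c e = q' => hqq (Subtype.ext (h.2.symm.trans h'.2)), mul_zero]
      · rw [if_neg h, zero_mul, zero_mul]
  obtain ⟨w, hw⟩ : ∃ w : α → ℝ, ∀ e, w e = 1 := ⟨fun _ => 1, fun _ => rfl⟩
  have hone : (B * diagonal w * Bᵀ).det = (Finset.univ.filter Q).card := by
    rw [hgram]
    simp [hw]
  have hne : (B * diagonal w * Bᵀ).det ≠ 0 := by
    rw [hdiag, Finset.prod_ne_zero_iff]
    intro q _
    simp only [hw]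
    rw [Finset.sum_const, hc q.1 q.2]
    norm_num
  have hgen : ∀ s : α → ℝ,
      ∑ T, (if Q T then 1 / ((Finset.univ.filter Q).card : ℝ) else 0) * ∏ e ∈ T, s e =
        (B * diagonal (fun e => s e * w e) * Bᵀ).det /
          (B * diagonal w * Bᵀ).det := by
    intro s
    rw [hone, hgram, Finset.sum_div, Finset.sum_filter]
    refine Finset.sum_congr rfl fun T _ => ?_
    split_ifs
    · simp only [hw, mul_one]
      ring
    · rw [zero_mul]
  refine isHalfDeterminantal_of_det_gram B w (fun e => by rw [hw]; exact zero_le_one) _ hne hgen E ?_ ?_ ?_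
  · intro T
    split_ifs <;> positivity
  · intro T hT
    by_contra h
    exact hT (if_neg fun h' => h ((hQ T).1 h').1)
  · intro e he
    set N : ℝ := ((Finset.univ.filter Q).card : ℝ) with hN
    have hs := hgen fun e' => if e' = e then -1 else 1
    have h1 := hgen fun _ => 1
    -- The factor of the class of `e` is `-1 + 1`, since the class has two elements. So the expected
    -- sign of `e` is 0, and its marginal is 1/2.
    have hzero : (B * diagonal (fun e' => (if e' = e then (-1 : ℝ) else 1) * w e') * Bᵀ).det = 0 := by
      rw [hdiag, Finset.prod_eq_zero_iff]
      refine ⟨⟨c e, Finset.mem_image_of_mem c he⟩, Finset.mem_univ _, ?_⟩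
      have hmem : e ∈ E.filter (fun e' => c e' = c e) := Finset.mem_filter.2 ⟨he, rfl⟩
      simp only [hw, mul_one]
      rw [← Finset.add_sum_erase _ _ hmem, if_pos rfl,
        Finset.sum_congr rfl (g := fun _ => (1 : ℝ))]
      · rw [Finset.sum_const, Finset.card_erase_of_mem hmem,
          hc (c e) (Finset.mem_image_of_mem c he)]
        norm_num
      · intro e' he'
        rw [if_neg (Finset.ne_of_mem_erase he')]
    rw [hzero, zero_div] at hs
    simp only [one_mul, mul_one, div_self hne, Finset.prod_const_one] at h1
    have h2 : ∀ T : Finset α, ∏ e' ∈ T, (if e' = e then (-1 : ℝ) else 1) =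
        1 - 2 * if e ∈ T then 1 else 0 := by
      intro T
      rw [Finset.prod_ite_eq' T e fun _ => (-1 : ℝ)]
      split_ifs <;> norm_num
    simp only [h2, mul_sub, mul_one, Finset.sum_sub_distrib, h1] at hs
    rw [Finset.sum_filter]
    have h3 : ∀ T : Finset α, (if Q T then 1 / N else 0) * (2 * if e ∈ T then (1 : ℝ) else 0) =
        2 * if e ∈ T then (if Q T then 1 / N else 0) else 0 := by
      intro T
      split_ifs <;> ring
    simp only [h3, ← Finset.mul_sum] at hs
    linarith

namespace IsContraction

variable {G : Finset (Edge V)} {P : Finset (Finset V)}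

/-- The uniform distribution on the tours of a cycle with doubled edges is determinantal. -/
theorem isHalfDeterminantal_tourLaw (hP : IsContraction G P)
    (hG : ∀ S : Finset V, S.Nonempty → S ≠ Finset.univ → 4 ≤ (cut G S).card)
    (hd : ∀ X ∈ P, ∀ Y ∈ P, X ≠ Y → (joinEdges G X Y).card = 0 ∨ (joinEdges G X Y).card = 2)
    (h3 : 3 ≤ P.card) {f : Sym2 V} (hf : ∀ i : Fin 2, ((f, i) : Edge V) ∈ G)
    (hfP : ∀ X ∈ P, ¬ ∀ v ∈ f, v ∈ X) :
    IsHalfDeterminantal (tourLaw G f P) (innerEdges G P) := by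
  classical
  choose node hnode hmem using hP.cover
  -- The fibres of this map on the inner edges are the parallel classes.
  set c : Edge V → Sym2 (Finset V) := fun e => e.1.map node with hc
  have hcJ : ∀ X ∈ P, ∀ Y ∈ P, ∀ e, c e = s(X, Y) ↔ Joins e X Y := by
    intro X hX Y hY e
    constructor
    · intro h
      obtain ⟨p, i⟩ := e
      induction p using Sym2.ind with
      | _ u v =>
        simp only [hc, Sym2.map_mk] at h
        rcases Sym2.eq_iff.1 h with ⟨rfl, rfl⟩ | ⟨rfl, rfl⟩
        · exact ⟨u, hmem u, v, hmem v, rfl⟩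
        · exact ⟨v, hmem v, u, hmem u, Sym2.eq_swap⟩
    · rintro ⟨u, hu, v, hv, huv⟩
      have h1 := (mem_iff_eq_of_pairwiseDisjoint hP.disjoint hX (hnode u) hu).1 (hmem u)
      have h2 := (mem_iff_eq_of_pairwiseDisjoint hP.disjoint hY (hnode v) hv).1 (hmem v)
      simp only [hc, huv, Sym2.map_mk, h1, h2]
  have hfib : ∀ T ⊆ innerEdges G P, ∀ X ∈ P, ∀ Y ∈ P,
      T.filter (fun e => c e = s(X, Y)) = T ∩ joinEdges G X Y := by
    intro T hT X hX Y hY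
    ext e
    rw [Finset.mem_filter, Finset.mem_inter, hcJ X hX Y hY, mem_joinEdges]
    exact ⟨fun h => ⟨h.1, (mem_innerEdges.1 (hT h.1)).1, h.2⟩, fun h => ⟨h.1, h.2.2⟩⟩
  have himg : ∀ q, q ∈ (innerEdges G P).image c ↔
      ∃ X ∈ P, ∃ Y ∈ P, X ≠ Y ∧ q = s(X, Y) ∧ (joinEdges G X Y).card = 2 := by
    intro q
    rw [Finset.mem_image]
    constructor
    · rintro ⟨e, he, rfl⟩
      obtain ⟨heG, X, hX, Y, hY, hXY, hJ⟩ := mem_innerEdges.1 he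
      refine ⟨X, hX, Y, hY, hXY, (hcJ X hX Y hY e).2 hJ, (hd X hX Y hY hXY).resolve_left ?_⟩
      exact (Finset.card_pos.2 ⟨e, mem_joinEdges.2 ⟨heG, hJ⟩⟩).ne'
    · rintro ⟨X, hX, Y, hY, hXY, rfl, h2⟩
      obtain ⟨e, he⟩ := Finset.card_pos.1 (by omega : 0 < (joinEdges G X Y).card)
      exact ⟨e, joinEdges_subset_innerEdges hX hY hXY he,
        (hcJ X hX Y hY e).2 (mem_joinEdges.1 he).2⟩
  have hfib' : ∀ X ∈ P, ∀ Y ∈ P, X ≠ Y →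
      (innerEdges G P).filter (fun e => c e = s(X, Y)) = joinEdges G X Y := by
    intro X hX Y hY hXY
    rw [hfib _ le_rfl X hX Y hY, Finset.inter_eq_right]
    exact joinEdges_subset_innerEdges hX hY hXY
  have h := isHalfDeterminantal_transversal (innerEdges G P) c ?_ (IsTour G f P) ?_
  · convert h using 1
    funext T
    unfold tourLaw
    congr
  · intro q hq
    obtain ⟨X, hX, Y, hY, hXY, rfl, h2⟩ := (himg q).1 hq
    rw [hfib' X hX Y hY hXY, h2]
  · intro T
    rw [hP.isTour_iff hG hd h3 hf hfP]
    refine and_congr_right fun hT => ⟨fun h q hq => ?_, fun h X hX Y hY hXY => ?_⟩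
    · obtain ⟨X, hX, Y, hY, hXY, rfl, h2⟩ := (himg q).1 hq
      have := h X hX Y hY hXY
      rw [hfib T hT X hX Y hY]
      omega
    · rcases hd X hX Y hY hXY with h0 | h2
      · have := Finset.card_le_card (Finset.inter_subset_right (s₁ := T) (s₂ := joinEdges G X Y))
        omega
      · have := h s(X, Y) ((himg _).2 ⟨X, hX, Y, hY, hXY, rfl, h2⟩)
        rw [hfib T hT X hX Y hY] at this
        omega

/-- Cuts are additive modulo 2, so parity at the single nodes determines parity at every union of
nodes. -/
theorem cut_union {X W : Finset V} (h : Disjoint X W) :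
    cut G (X ∪ W) = symmDiff (cut G X) (cut G W) := by
  have key : ∀ (Z : Finset V) (u v : V) (i : Fin 2),
      Joins ((s(u, v), i) : Edge V) Z Zᶜ ↔ ((u ∈ Z ∧ v ∉ Z) ∨ (v ∈ Z ∧ u ∉ Z)) := by
    intro Z u v i
    constructor
    · rintro ⟨u', hu', v', hv', he⟩
      rw [Finset.mem_compl] at hv'
      rcases Sym2.eq_iff.1 he with ⟨rfl, rfl⟩ | ⟨rfl, rfl⟩
      · exact Or.inl ⟨hu', hv'⟩
      · exact Or.inr ⟨hu', hv'⟩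
    · rintro (⟨hu, hv⟩ | ⟨hv, hu⟩)
      · exact ⟨u, hu, v, Finset.mem_compl.2 hv, rfl⟩
      · exact ⟨v, hv, u, Finset.mem_compl.2 hu, Sym2.eq_swap⟩
  ext ⟨p, i⟩
  induction p using Sym2.ind with
  | _ u v =>
    have h1 : u ∈ X → u ∉ W := fun h' => Finset.disjoint_left.1 h h'
    have h2 : v ∈ X → v ∉ W := fun h' => Finset.disjoint_left.1 h h'
    rw [Finset.mem_symmDiff, mem_cut, mem_cut, mem_cut, key, key, key, Finset.mem_union,
      Finset.mem_union]
    tauto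

theorem even_card_inter_cut_verts (hP : IsContraction G P) (T : Finset (Edge V))
    (B : Finset (Finset V)) (hB : B ⊆ P) (h : ∀ X ∈ B, Even (T ∩ cut G X).card) :
    Even (T ∩ cut G (verts B)).card := by
  induction B using Finset.induction_on with
  | empty =>
    have : cut G (verts ∅) = ∅ := by
      ext e
      simp [mem_cut, Joins, verts]
    simp [this]
  | insert X B hX ih =>
    have hB' := (Finset.subset_insert X B).trans hB
    have h1 := h X (Finset.mem_insert_self X B)
    have h2 := ih hB' fun Y hY => h Y (Finset.mem_insert_of_mem hY)
    have hv : verts (insert X B) = X ∪ verts B := by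
      simp [verts, Finset.biUnion_insert]
    have hd := hP.disjoint_verts hB' (hB (Finset.mem_insert_self X B)) hX
    rw [hv, cut_union hd]
    set C := T ∩ cut G X
    set D := T ∩ cut G (verts B)
    have hCD : T ∩ symmDiff (cut G X) (cut G (verts B)) = (C \ D) ∪ (D \ C) := by
      ext e
      simp only [C, D, Finset.mem_inter, Finset.mem_symmDiff, Finset.mem_union, Finset.mem_sdiff]
      tauto
    have hdis : Disjoint (C \ D) (D \ C) := by
      rw [Finset.disjoint_left]
      intro e h1 h2
      exact (Finset.mem_sdiff.1 h1).2 (Finset.mem_sdiff.1 h2).1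
    rw [hCD, Finset.card_union_of_disjoint hdis]
    have e1 := Finset.card_sdiff_add_card_inter C D
    have e2 := Finset.card_sdiff_add_card_inter D C
    rw [Finset.inter_comm] at e2
    rw [Nat.even_iff] at *
    omega

end IsContraction

theorem IsHalfDeterminantal.sum_eq_one {α : Type*} [Fintype α] [DecidableEq α]
    {p : Finset α → ℝ} {E : Finset α} (h : IsHalfDeterminantal p E) : ∑ T, p T = 1 := by
  obtain ⟨K, -, -, -, -, hK⟩ := h.kernel
  simpa using hK 0 (fun i => i.elim0) (fun i => i.elim0)

/-- A random spanning tree with marginals `1 / 2` contains exactly one of two parallel edges. -/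
theorem IsMaxEntropy.card_inter_joinEdges {G : Finset (Edge V)} {A : Finset (Finset V)}
    (hA : (A : Set (Finset V)).PairwiseDisjoint id) {p : Finset (Edge V) → ℝ}
    (hp : IsMaxEntropy G A p) {X Y : Finset V} (hX : X ∈ A) (hY : Y ∈ A) (hXY : X ≠ Y)
    (h2 : (joinEdges G X Y).card = 2) {T : Finset (Edge V)} (hT : p T ≠ 0) :
    (T ∩ joinEdges G X Y).card = 1 := by
  classical
  obtain ⟨a, b, hab, hJ⟩ := Finset.card_eq_two.1 h2
  have hdet := hp.isHalfDeterminantal hA ⟨X, hX⟩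
  have hmem : ∀ e ∈ joinEdges G X Y, e ∈ innerEdges G A ∧ Joins e X Y := fun e he =>
    ⟨IsContraction.joinEdges_subset_innerEdges hX hY hXY he, (mem_joinEdges.1 he).2⟩
  have ha := hmem a (by rw [hJ]; simp)
  have hb := hmem b (by rw [hJ]; simp)
  have htree : ∀ T, p T ≠ 0 → IsSpanningTree G A T := by
    intro T hT
    obtain ⟨⟨w, -, -, hw⟩, -⟩ := hp
    rw [hw] at hT
    by_contra h
    exact hT (if_neg h)
  have hnot : ∀ T, p T ≠ 0 → ¬ (a ∈ T ∧ b ∈ T) := fun T hT h =>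
    (htree T hT).not_parallel hA hab h.1 h.2 hX hY ha.2 hb.2
  have hma := hp.2 a ha.1
  have hmb := hp.2 b hb.1
  rw [Finset.sum_filter] at hma hmb
  -- The expected number of chosen edges among `a` and `b` is 1. As it never exceeds 1 with positive
  -- probability, these nonnegative terms all vanish.
  have hzero : ∑ T, p T * (1 - (if a ∈ T then 1 else 0) - if b ∈ T then 1 else 0) = 0 := by
    have h1 : ∀ T, p T * (1 - (if a ∈ T then 1 else 0) - if b ∈ T then 1 else 0) =
        p T - (if a ∈ T then p T else 0) - if b ∈ T then p T else 0 := by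
      intro T
      split_ifs <;> ring
    simp only [h1, Finset.sum_sub_distrib]
    rw [hdet.sum_eq_one]
    have hma' : ∑ T, (if a ∈ T then p T else 0) = 1 / 2 := by rw [← hma]
    have hmb' : ∑ T, (if b ∈ T then p T else 0) = 1 / 2 := by rw [← hmb]
    rw [hma', hmb']
    norm_num
  have hnn : ∀ T ∈ (Finset.univ : Finset (Finset (Edge V))),
      0 ≤ p T * (1 - (if a ∈ T then 1 else 0) - if b ∈ T then 1 else 0) := by
    intro T _
    by_cases h0 : p T = 0
    · rw [h0, zero_mul]
    · refine mul_nonneg (hdet.nonneg T) ?_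
      have := hnot T h0
      by_cases h1 : a ∈ T <;> by_cases h2 : b ∈ T <;> simp_all
  have hT0 := (Finset.sum_eq_zero_iff_of_nonneg hnn).1 hzero T (Finset.mem_univ T)
  have hT1 := (mul_eq_zero.1 hT0).resolve_left hT
  have hT2 := hnot T hT
  rw [hJ]
  by_cases h1 : a ∈ T <;> by_cases h2 : b ∈ T
  · exact absurd ⟨h1, h2⟩ hT2
  · rw [Finset.inter_insert_of_mem h1, Finset.inter_singleton_of_notMem h2]
    simp
  · rw [Finset.inter_insert_of_notMem h1, Finset.inter_singleton_of_mem h2]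
    simp
  · simp [h1, h2] at hT1

/-! ### Probabilities of events in an execution. -/

namespace Execution

variable {G : Finset (Edge V)} {f : Sym2 V} (R : Execution G f)

/-- Outcomes of nonzero weight stay within their disjoint ground sets, so whether an edge is in `T`
is decided by one round. -/
theorem mem_biUnion_iff (hG : ∀ u : V, (cut G {u}).card = 4)
    (hdet : ∀ i : Fin (R.k + 1), IsHalfDeterminantal (R.law i) (innerEdges G (R.sel i)))
    {ω : Fin (R.k + 1) → Finset (Edge V)} (hω : ∏ i : Fin (R.k + 1), R.law i (ω i) ≠ 0)
    (i : Fin (R.k + 1)) {e : Edge V} (he : e ∈ innerEdges G (R.sel i)) :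
    e ∈ Finset.univ.biUnion ω ↔ e ∈ ω i := by
  constructor
  · intro h
    obtain ⟨j, -, hj⟩ := Finset.mem_biUnion.1 h
    have hsub := (hdet j).support _ (Finset.prod_ne_zero_iff.1 hω j (Finset.mem_univ j))
    by_contra hcon
    have hji : (j : ℕ) ≠ i := fun h' => hcon (Fin.ext h' ▸ hj)
    exact Finset.disjoint_left.1 (R.disjoint_innerEdges hG hji (Nat.lt_succ_iff.1 j.2)
      (Nat.lt_succ_iff.1 i.2)) (hsub hj) he
  · exact fun h => Finset.mem_biUnion.2 ⟨i, Finset.mem_univ i, h⟩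

theorem inter_biUnion_eq (hG : ∀ u : V, (cut G {u}).card = 4)
    (hdet : ∀ i : Fin (R.k + 1), IsHalfDeterminantal (R.law i) (innerEdges G (R.sel i)))
    {ω : Fin (R.k + 1) → Finset (Edge V)} (hω : ∏ i : Fin (R.k + 1), R.law i (ω i) ≠ 0)
    (i : Fin (R.k + 1)) {D : Finset (Edge V)} (hD : D ⊆ innerEdges G (R.sel i)) :
    Finset.univ.biUnion ω ∩ D = ω i ∩ D := by
  ext e
  rw [Finset.mem_inter, Finset.mem_inter]
  exact and_congr_left fun he => R.mem_biUnion_iff hG hdet hω i (hD he)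

open Classical in
theorem le_prob_of_imp
    (hdet : ∀ i : Fin (R.k + 1), IsHalfDeterminantal (R.law i) (innerEdges G (R.sel i)))
    {Q Q' : Finset (Edge V) → Prop} {r : ℝ} (hr : r ≤ R.prob Q)
    (h : ∀ ω : Fin (R.k + 1) → Finset (Edge V), ∏ i : Fin (R.k + 1), R.law i (ω i) ≠ 0 →
      Q (Finset.univ.biUnion ω) → Q' (Finset.univ.biUnion ω)) : r ≤ R.prob Q' := by
  refine hr.trans (Finset.sum_le_sum fun ω _ => ?_)
  have hnn : 0 ≤ ∏ i : Fin (R.k + 1), R.law i (ω i) :=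
    Finset.prod_nonneg fun i _ => (hdet i).nonneg _
  by_cases h0 : ∏ i : Fin (R.k + 1), R.law i (ω i) = 0
  · rw [h0, ite_self, ite_self]
  · by_cases hQ : Q (Finset.univ.biUnion ω)
    · rw [if_pos hQ, if_pos (h ω h0 hQ)]
    · rw [if_neg hQ]
      split_ifs
      · exact hnn
      · exact le_rfl

theorem prob_true
    (hdet : ∀ i : Fin (R.k + 1), IsHalfDeterminantal (R.law i) (innerEdges G (R.sel i))) :
    R.prob (fun _ => True) = 1 := by
  simp only [prob, if_true]
  have h : ∏ i : Fin (R.k + 1), ∑ T, R.law i T = 1 :=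
    Finset.prod_eq_one fun i _ => (hdet i).sum_eq_one
  rw [Finset.prod_univ_sum] at h
  rw [← h]
  exact Finset.sum_congr (by simp) fun _ _ => rfl

/-- Two disjoint pairs of edges are both split with probability at least `1 / 4`. -/
theorem quarter_le_prob_split (hG : ∀ u : V, (cut G {u}).card = 4)
    (hloop : ∀ e ∈ G, ¬ e.1.IsDiag)
    (hdet : ∀ i : Fin (R.k + 1), IsHalfDeterminantal (R.law i) (innerEdges G (R.sel i)))
    (a : Fin 4 → Edge V) (ha : Function.Injective a) (haG : ∀ j, a j ∈ G) :
    1 / 4 ≤ R.prob fun T => Xor (a 0 ∈ T) (a 1 ∈ T) ∧ Xor (a 2 ∈ T) (a 3 ∈ T) := by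
  classical
  obtain ⟨K, hKs, hK, hK2, hKd⟩ := exists_kernel_biUnion (fun i : Fin (R.k + 1) => R.law i)
    (fun i => innerEdges G (R.sel i)) hdet fun i j hij => R.disjoint_innerEdges hG
      (fun h => hij (Fin.ext h)) (Nat.lt_succ_iff.1 i.2) (Nat.lt_succ_iff.1 j.2)
  have h := quarter_le_split (fun ω : Fin (R.k + 1) → Finset (Edge V) =>
    ∏ i : Fin (R.k + 1), R.law i (ω i)) (fun ω => Finset.univ.biUnion ω) K hKs hK
    (fun m a ha => by convert hKd m a ha) a ha ?_
  · convert h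
    unfold prob
    exact Finset.sum_congr rfl fun ω _ => by congr
  · intro j
    obtain ⟨i, hi, he⟩ := R.exists_mem_innerEdges hG hloop (haG j)
    exact hK2 ⟨i, Nat.lt_succ_of_le hi⟩ _ he

end Execution

/-! ### Tight pairs and doubled edges at a node. -/

namespace IsContraction

variable {G : Finset (Edge V)} {P : Finset (Finset V)}

theorem joinEdges_subset_cut (hP : IsContraction G P) {X Y : Finset V} (hX : X ∈ P) (hY : Y ∈ P)
    (h : X ≠ Y) : joinEdges G X Y ⊆ cut G X := by
  rw [hP.cut_eq_biUnion hX]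
  exact Finset.subset_biUnion_of_mem _ (Finset.mem_erase.2 ⟨h.symm, hY⟩)

/-- Two nodes joined by two edges form a tight set. -/
theorem isTight_pair (hP : IsContraction G P)
    (hG : ∀ S : Finset V, S.Nonempty → S ≠ Finset.univ → 4 ≤ (cut G S).card)
    (h3 : 3 ≤ P.card) {X Y : Finset V} (hX : X ∈ P) (hY : Y ∈ P) (hXY : X ≠ Y)
    (h2 : 2 ≤ (joinEdges G X Y).card) : IsTight G {X, Y} := by
  have hsub : ({X, Y} : Finset (Finset V)) ⊆ P := by
    intro Z hZ
    rw [Finset.mem_insert, Finset.mem_singleton] at hZ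
    rcases hZ with rfl | rfl <;> assumption
  have hne : (P \ {X, Y}).Nonempty := by
    rw [← Finset.card_pos, Finset.card_sdiff_of_subset hsub, Finset.card_pair hXY]
    omega
  have h4 := hG (verts {X, Y}) (hP.verts_nonempty hsub ⟨X, by simp⟩) (hP.verts_ne_univ hsub hne)
  -- Two nodes of degree 4 with at least two common edges have a joint boundary of at most 4 + 4 - 2
  -- · 2 edges.
  refine le_antisymm ?_ h4
  have hv : verts {X, Y} = X ∪ Y := by simp [verts]
  rw [hv, cut_union (hP.disjoint_of_ne hX hY hXY)]
  have hXc := hP.card_cut X hX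
  have hYc := hP.card_cut Y hY
  have hJ : 2 ≤ (cut G X ∩ cut G Y).card := by
    refine h2.trans (Finset.card_le_card (Finset.subset_inter ?_ ?_))
    · exact hP.joinEdges_subset_cut hX hY hXY
    · rw [joinEdges_comm]
      exact hP.joinEdges_subset_cut hY hX hXY.symm
  have e1 := Finset.card_sdiff_add_card_inter (cut G X) (cut G Y)
  have e2 := Finset.card_sdiff_add_card_inter (cut G Y) (cut G X)
  rw [Finset.inter_comm] at e2
  have e3 : (symmDiff (cut G X) (cut G Y)).card ≤
      (cut G X \ cut G Y).card + (cut G Y \ cut G X).card := Finset.card_union_le _ _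
  omega

/-- If all edges at a node are doubled, then its four edges form two parallel pairs. -/
theorem exists_pair_of_doubled (hP : IsContraction G P) {O : Finset V} (hO : O ∈ P)
    (hd : ∀ X ∈ P, X ≠ O → (joinEdges G O X).card = 0 ∨ (joinEdges G O X).card = 2) :
    ∃ X ∈ P, ∃ Y ∈ P, X ≠ O ∧ Y ≠ O ∧ X ≠ Y ∧ (joinEdges G O X).card = 2 ∧
      (joinEdges G O Y).card = 2 ∧ ∀ Z ∈ P, Z ≠ O → Z ≠ X → Z ≠ Y → joinEdges G O Z = ∅ := by
  have hsum := hP.sum_card_joinEdges hO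
  have hd' : ∀ X ∈ P.erase O, (joinEdges G O X).card = 0 ∨ (joinEdges G O X).card = 2 :=
    fun X hX => hd X (Finset.mem_of_mem_erase hX) (Finset.ne_of_mem_erase hX)
  obtain ⟨X, hX, hX0⟩ := Finset.exists_ne_zero_of_sum_ne_zero (by rw [hsum]; norm_num)
  have hX2 := (hd' X hX).resolve_left hX0
  rw [← Finset.add_sum_erase _ _ hX, hX2] at hsum
  obtain ⟨Y, hY, hY0⟩ := Finset.exists_ne_zero_of_sum_ne_zero
    (s := (P.erase O).erase X) (f := fun Y => (joinEdges G O Y).card) (by omega)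
  have hYe := Finset.mem_of_mem_erase hY
  have hY2 := (hd' Y hYe).resolve_left hY0
  rw [← Finset.add_sum_erase _ _ hY, hY2] at hsum
  have hrest : ∑ Z ∈ ((P.erase O).erase X).erase Y, (joinEdges G O Z).card = 0 := by omega
  rw [Finset.sum_eq_zero_iff] at hrest
  refine ⟨X, Finset.mem_of_mem_erase hX, Y, Finset.mem_of_mem_erase hYe, Finset.ne_of_mem_erase hX,
    Finset.ne_of_mem_erase hYe, (Finset.ne_of_mem_erase hY).symm, hX2, hY2, ?_⟩
  intro Z hZ hZO hZX hZY
  rw [← Finset.card_eq_zero]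
  exact hrest Z (by simp [hZ, hZO, hZX, hZY])

end IsContraction

/-! ### Evenness and split partners at a cycle cut. -/

namespace Execution

variable {G : Finset (Edge V)} {f : Sym2 V} (R : Execution G f)

/-- In the graph that remains at the end, all edges are doubled. -/
theorem card_joinEdges_last (hG4 : ∀ u : V, (cut G {u}).card = 4)
    (hG : ∀ S : Finset V, S.Nonempty → S ≠ Finset.univ → 4 ≤ (cut G S).card)
    (hV : 3 ≤ Fintype.card V) (hf : ∀ i : Fin 2, ((f, i) : Edge V) ∈ G) (hfd : ¬ f.IsDiag) :
    ∀ X ∈ R.nodes R.k, ∀ Y ∈ R.nodes R.k, X ≠ Y →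
      (joinEdges G X Y).card = 0 ∨ (joinEdges G X Y).card = 2 := by
  have hP := R.isContraction_nodes hG4 le_rfl
  have h3 := R.three_le_card_nodes hG4 hV le_rfl
  intro X hX Y hY hXY
  refine hP.card_joinEdges_eq hG R.loop_end ?_ hX hY hXY
  -- With more than three nodes, the two end nodes of `f` form a proper tight set, because both
  -- copies of `f` join them.
  by_cases h : (R.nodes R.k).card = 3
  · exact Or.inl h
  · right
    obtain ⟨X, hX, Y, hY, hJ⟩ := joins_exists hP.cover ((f, 0) : Edge V)
    have hXY : X ≠ Y := by
      rintro rfl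
      obtain ⟨u, hu, v, hv, huv⟩ := hJ
      refine R.not_forall_mem_node hfd le_rfl X hX fun w hw => ?_
      change f = s(u, v) at huv
      rw [huv, Sym2.mem_iff] at hw
      rcases hw with rfl | rfl <;> assumption
    have h2 : 2 ≤ (joinEdges G X Y).card := by
      have hne : ((f, 0) : Edge V) ≠ (f, 1) := by simp
      rw [← Finset.card_pair hne]
      refine Finset.card_le_card fun e he => ?_
      rw [Finset.mem_insert, Finset.mem_singleton] at he
      rcases he with rfl | rfl <;> exact mem_joinEdges.2 ⟨hf _, hJ⟩
    refine ⟨{X, Y}, ⟨?_, (Finset.card_pair hXY).ge, ?_⟩, hP.isTight_pair hG h3 hX hY hXY h2⟩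
    · intro Z hZ
      rw [Finset.mem_insert, Finset.mem_singleton] at hZ
      rcases hZ with rfl | rfl <;> assumption
    · have := Finset.le_card_sdiff {X, Y} (R.nodes R.k)
      rw [Finset.card_pair hXY] at this
      omega

theorem isHalfDeterminantal_law (hG4 : ∀ u : V, (cut G {u}).card = 4)
    (hG : ∀ S : Finset V, S.Nonempty → S ≠ Finset.univ → 4 ≤ (cut G S).card)
    (hV : 3 ≤ Fintype.card V) (hf : ∀ i : Fin 2, ((f, i) : Edge V) ∈ G) (hfd : ¬ f.IsDiag)
    (i : Fin (R.k + 1)) : IsHalfDeterminantal (R.law i) (innerEdges G (R.sel i)) := by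
  obtain ⟨i, hi⟩ := i
  rcases (Nat.lt_succ_iff.1 hi).lt_or_eq with h | rfl
  · have hP := R.isContraction_nodes hG4 h.le
    obtain ⟨⟨⟨h1, h2, -⟩, -⟩, -⟩ := R.sel_candidate i h
    exact (R.law_maxEntropy i h).isHalfDeterminantal
      (hP.disjoint.subset (by exact_mod_cast h1)) (Finset.card_pos.1 (by omega))
  · change IsHalfDeterminantal (R.law R.k) (innerEdges G (R.sel R.k))
    rw [R.law_last, R.sel_last]
    exact (R.isContraction_nodes hG4 le_rfl).isHalfDeterminantal_tourLaw hG
      (R.card_joinEdges_last hG4 hG hV hf hfd) (R.three_le_card_nodes hG4 hV le_rfl) hf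
      (R.not_forall_mem_node hfd le_rfl)

/-- The conjunction of "even at last" and "partners split" for a fixed index `i` of the parent. -/
theorem quarter_le_prob_even_and_split (hG4 : ∀ u : V, (cut G {u}).card = 4)
    (hG : ∀ S : Finset V, S.Nonempty → S ≠ Finset.univ → 4 ≤ (cut G S).card)
    (hV : 3 ≤ Fintype.card V) (hf : ∀ i : Fin 2, ((f, i) : Edge V) ∈ G) (hfd : ¬ f.IsDiag)
    (hloop : ∀ e ∈ G, ¬ e.1.IsDiag) {i : ℕ} (hi : i ≤ R.k) (hcyc : R.IsCycle i) :
    1 / 4 ≤ R.prob fun T => (∀ B ⊆ R.sel i, Even (T ∩ cut G (verts B)).card) ∧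
      ∀ a b, R.IsCyclePartners i a b → Xor (a ∈ T) (b ∈ T) := by
  have hdet := R.isHalfDeterminantal_law hG4 hG hV hf hfd
  have hP := R.isContraction_nodes hG4 hi
  rcases hi.lt_or_eq with hik | rfl
  · have hcand := R.sel_candidate i hik
    have hmin := R.sel_minimal i hik
    obtain ⟨⟨⟨hSP, hS2, hSc⟩, hSt, -⟩, -⟩ := hcand
    set S := R.sel i with hS
    set O := (verts S)ᶜ with hOdef
    have hQ : IsContraction G (insert O S) :=
      hP.contract_compl hSP (Finset.card_pos.1 (by omega)) hSt
    have hd : ∀ X ∈ insert O S, ∀ Y ∈ insert O S, X ≠ Y →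
        (joinEdges G X Y).card = 0 ∨ (joinEdges G X Y).card = 2 := fun X hX Y hY hXY =>
      hP.card_joinEdges_of_minimal hG (R.sel_candidate i hik) hmin
        (hcyc.resolve_left hik.ne) hX hY hXY
    have hOQ : O ∈ insert O S := Finset.mem_insert_self _ _
    have hSQ : ∀ X ∈ S, X ∈ insert O S := fun X hX => Finset.mem_insert_of_mem hX
    have hOS : ∀ X ∈ S, X ≠ O := by
      rintro X hX rfl
      obtain ⟨v, hv⟩ := hQ.nonempty O hOQ
      exact Finset.mem_compl.1 hv (subset_verts hX hv)
    have hcutS : cut G (verts S) = cut G O := (cut_compl G (verts S)).symm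
    obtain ⟨X, hX, Y, hY, hXO, hYO, hXY, hX2, hY2, hrest⟩ := hQ.exists_pair_of_doubled hOQ
      fun X hX hXO => hd O hOQ X hX hXO.symm
    obtain ⟨b₁, b₂, hb, hXb⟩ := Finset.card_eq_two.1 hX2
    obtain ⟨c₁, c₂, hc, hYc⟩ := Finset.card_eq_two.1 hY2
    have hdis : ∀ b ∈ joinEdges G O X, ∀ c ∈ joinEdges G O Y, b ≠ c := by
      rintro b hbX c hcY rfl
      rcases hQ.eq_of_joins hOQ hX hOQ hY (mem_joinEdges.1 hbX).2 (mem_joinEdges.1 hcY).2 with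
        ⟨-, h⟩ | ⟨-, h⟩
      · exact hXY h.symm
      · exact hYO h
    have hb₁ : b₁ ∈ joinEdges G O X := by rw [hXb]; simp
    have hb₂ : b₂ ∈ joinEdges G O X := by rw [hXb]; simp
    have hc₁ : c₁ ∈ joinEdges G O Y := by rw [hYc]; simp
    have hc₂ : c₂ ∈ joinEdges G O Y := by rw [hYc]; simp
    -- These four edges may be sampled in different rounds, so the kernel of the whole union is
    -- needed.
    have hsplit := R.quarter_le_prob_split hG4 hloop hdet ![b₁, b₂, c₁, c₂] ?_ ?_
    rotate_left
    · have h1 := hdis b₁ hb₁ c₁ hc₁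
      have h2 := hdis b₁ hb₁ c₂ hc₂
      have h3 := hdis b₂ hb₂ c₁ hc₁
      have h4 := hdis b₂ hb₂ c₂ hc₂
      intro j l hjl
      fin_cases j <;> fin_cases l <;> simp_all
    · intro j
      fin_cases j
      · exact (mem_joinEdges.1 hb₁).1
      · exact (mem_joinEdges.1 hb₂).1
      · exact (mem_joinEdges.1 hc₁).1
      · exact (mem_joinEdges.1 hc₂).1
    refine R.le_prob_of_imp hdet hsplit fun ω hω hxor => ?_
    change Xor (b₁ ∈ _) (b₂ ∈ _) ∧ Xor (c₁ ∈ _) (c₂ ∈ _) at hxor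
    set T := Finset.univ.biUnion ω with hT
    have hone : ∀ (a b : Edge V) (D : Finset (Edge V)), D = {a, b} → Xor (a ∈ T) (b ∈ T) →
        (T ∩ D).card = 1 := by
      rintro a b D rfl (⟨h1, h2⟩ | ⟨h1, h2⟩)
      · rw [Finset.inter_insert_of_mem h1, Finset.inter_singleton_of_notMem h2]
        simp
      · rw [Finset.inter_insert_of_notMem h2, Finset.inter_singleton_of_mem h1]
        simp
    have hbd : ∀ Z ∈ S, 2 * (T ∩ joinEdges G O Z).card = (joinEdges G O Z).card := by
      intro Z hZ
      by_cases hZX : Z = X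
      · rw [hZX, hone b₁ b₂ _ hXb hxor.1, hX2]
      by_cases hZY : Z = Y
      · rw [hZY, hone c₁ c₂ _ hYc hxor.2, hY2]
      · rw [hrest Z (hSQ Z hZ) (hOS Z hZ) hZX hZY]
        simp
    -- Inside `S` the sampled tree splits every parallel pair almost surely, so only the boundary
    -- costs probability.
    have hin : ∀ Z ∈ S, ∀ W ∈ S, Z ≠ W →
        2 * (T ∩ joinEdges G Z W).card = (joinEdges G Z W).card := by
      intro Z hZ W hW hZW
      rcases hd Z (hSQ Z hZ) W (hSQ W hW) hZW with h0 | h2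
      · have := Finset.card_le_card (Finset.inter_subset_right (s₁ := T) (s₂ := joinEdges G Z W))
        omega
      · have hi' : i < R.k + 1 := Nat.lt_succ_of_lt hik
        rw [hT, R.inter_biUnion_eq hG4 hdet hω ⟨i, hi'⟩
          (IsContraction.joinEdges_subset_innerEdges hZ hW hZW), h2,
          (R.law_maxEntropy i hik).card_inter_joinEdges
            (hP.disjoint.subset (by exact_mod_cast hSP)) hZ hW hZW h2
            (Finset.prod_ne_zero_iff.1 hω ⟨i, hi'⟩ (Finset.mem_univ _))]
    refine ⟨fun B hB => hQ.even_card_inter_cut_verts T B (hB.trans (Finset.subset_insert _ _))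
      fun Z hZB => ?_, fun a b hab => ?_⟩
    · have hZ := hB hZB
      have h2 : ∑ W ∈ (insert O S).erase Z, 2 * (T ∩ joinEdges G Z W).card =
          ∑ W ∈ (insert O S).erase Z, (joinEdges G Z W).card := by
        refine Finset.sum_congr rfl fun W hW => ?_
        rw [Finset.mem_erase, Finset.mem_insert] at hW
        rcases hW.2 with rfl | hWS
        · rw [joinEdges_comm]
          exact hbd Z hZ
        · exact hin Z hZ W hWS hW.1.symm
      rw [← Finset.mul_sum, ← hQ.card_inter_cut (hSQ Z hZ),
        hQ.sum_card_joinEdges (hSQ Z hZ)] at h2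
      exact ⟨1, by omega⟩
    · obtain ⟨hne, haS, hbS, Z, hZ, haZ, hbZ⟩ := hab
      -- Cycle partners ending at `Z` are parallel edges between `Z` and the contracted outside.
      have hmem : ∀ e, e ∈ cut G (verts S) → e ∈ cut G Z → e ∈ joinEdges G O Z := by
        intro e he heZ
        rw [hcutS, hQ.cut_eq_biUnion hOQ, Finset.mem_biUnion] at he
        rw [hQ.cut_eq_biUnion (hSQ Z hZ), Finset.mem_biUnion] at heZ
        obtain ⟨W, hW, heW⟩ := he
        obtain ⟨W', hW', heW'⟩ := heZ
        rw [Finset.mem_erase] at hW hW'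
        rcases hQ.eq_of_joins hOQ hW.2 (hSQ Z hZ) hW'.2 (mem_joinEdges.1 heW).2
          (mem_joinEdges.1 heW').2 with ⟨h, -⟩ | ⟨h, -⟩
        · exact absurd h (hOS Z hZ)
        · rwa [h]
      have ha := hmem a haS haZ
      have hb' := hmem b hbS hbZ
      have key : ∀ p q : Edge V, joinEdges G O Z = {p, q} → Xor (p ∈ T) (q ∈ T) →
          Xor (a ∈ T) (b ∈ T) := by
        intro p q hpq hx
        rw [hpq, Finset.mem_insert, Finset.mem_singleton] at ha hb'
        rcases ha with rfl | rfl <;> rcases hb' with rfl | rfl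
        · exact absurd rfl hne
        · exact hx
        · exact hx.symm
        · exact absurd rfl hne
      by_cases hZX : Z = X
      · exact key b₁ b₂ (hZX ▸ hXb) hxor.1
      by_cases hZY : Z = Y
      · exact key c₁ c₂ (hZY ▸ hYc) hxor.2
      · rw [hrest Z (hSQ Z hZ) (hOS Z hZ) hZX hZY] at ha
        simp at ha
  -- At the root both properties hold almost surely: the tour has degree 2 at every node, and the
  -- boundary of the whole vertex set is empty.
  · have htrue : (1 : ℝ) / 4 ≤ R.prob fun _ => True := by
      rw [R.prob_true hdet]
      norm_num
    refine R.le_prob_of_imp hdet htrue fun ω hω _ => ?_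
    have htour : IsTour G f (R.nodes R.k) (ω (Fin.last R.k)) := by
      have h := Finset.prod_ne_zero_iff.1 hω (Fin.last R.k) (Finset.mem_univ _)
      rw [Fin.val_last, R.law_last] at h
      by_contra hcon
      exact h (if_neg hcon)
    rw [R.sel_last]
    refine ⟨fun B hB => hP.even_card_inter_cut_verts _ B hB fun X hX => ?_, fun a b hab => ?_⟩
    · have hsub : cut G X ⊆ innerEdges G (R.sel (Fin.last R.k : Fin (R.k + 1))) := by
        rw [Fin.val_last, R.sel_last]
        exact hP.cut_subset_innerEdges (hB hX)
      rw [R.inter_biUnion_eq hG4 hdet hω (Fin.last R.k) hsub, htour.2.2.1 X (hB hX)]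
      exact even_two
    · obtain ⟨-, ha, -⟩ := hab
      rw [R.sel_last, mem_cut] at ha
      obtain ⟨-, u, -, v, hv, -⟩ := ha
      obtain ⟨X, hX, hvX⟩ := hP.cover v
      exact absurd (subset_verts hX hvX) (Finset.mem_compl.1 hv)

end Execution

end HalfIntegralTSP

/-! ### The bottom edge lemma. -/

theorem mainTheorem6 {V : Type*} [Fintype V] [DecidableEq V] (x : Sym2 V → ℝ)
    (hx : HalfIntegralTSP.IsHalfIntegralSubtour x) (f : Sym2 V) (hf : x f = 1)
    (R : HalfIntegralTSP.Execution (HalfIntegralTSP.supportGraph x) f)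
    (e : Edge V) (he : e ∈ HalfIntegralTSP.supportGraph x) (hb : R.IsBottom e) :
    R.IsGood e (3 / 16) ∧ 3 / 16 ≤ R.prob (R.PartnersSplit e) := by
  open HalfIntegralTSP in
  have hdiag : ∀ p : Sym2 V, p.IsDiag → x p = 0 := by
    intro p hp
    induction p using Sym2.ind with
    | _ a b =>
      rw [Sym2.mk_isDiag_iff] at hp
      rw [hp, hx.loopless]
  have hfd : ¬ f.IsDiag := fun h => by
    rw [hdiag f h] at hf
    exact zero_ne_one hf
  have hloop : ∀ e ∈ supportGraph x, ¬ e.1.IsDiag := by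
    intro e he h
    rw [mem_supportGraph, hdiag _ h] at he
    have : (0 : ℝ) ≤ ((e.2 : ℕ) : ℝ) := Nat.cast_nonneg _
    linarith
  have hfG : ∀ i : Fin 2, ((f, i) : Edge V) ∈ supportGraph x := by
    intro i
    rw [mem_supportGraph, hf]
    have : ((i : ℕ) : ℝ) ≤ 1 := by exact_mod_cast Nat.lt_succ_iff.1 i.2
    change ((i : ℕ) : ℝ) + 1 ≤ 2 * 1
    linarith
  have hG4 := card_cut_singleton hx
  have hG := four_le_card_cut hx
  -- An end point of `e` serves as the vertex that shows `V` to be nonempty.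
  have hV : 3 ≤ Fintype.card V := three_le_card hx e.1.out.1
  obtain ⟨i, hi, hcyc⟩ := hb
  have hdet := R.isHalfDeterminantal_law hG4 hG hV hfG hfd
  have hmain := R.quarter_le_prob_even_and_split hG4 hG hV hfG hfd hloop hi.1 hcyc
  have hmain' : (3 : ℝ) / 16 ≤ _ := le_trans (by norm_num) hmain
  refine ⟨⟨by norm_num, R.le_prob_of_imp hdet hmain' fun ω _ h => ?_⟩,
    R.le_prob_of_imp hdet hmain' fun ω _ h => ?_⟩
  -- All cuts given by nodes of the selected set are even here, whether or not they are tight or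
  -- contain `e`.
  · exact ⟨i, hi, fun _ B hB _ _ => h.1 B hB, fun hn => absurd hcyc hn⟩
  · exact ⟨i, hi, h.2⟩
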